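/- Let $d\ge 2$, $b\ge 1$ and $N$ be integers, and let $$f_X(x)=\frac{\Gamma(d/2)}{\sqrt{\pi}\,\Gamma((d-1)/2)}\,(1-x^2)^{(d-3)/2},\qquad x\in[-1,1],$$ be the density of a coordinate of a uniformly distributed point of $\mathbb S^{d-1}$. A *Lloyd–Max codebook* is a minimizer $c=(c_1,\dots,c_{2^b})$ of $$\sum_{i=1}^{2^b}\int_{t_{i-1}}^{t_i}|x-c_i|^2 f_X(x)\,dx \quad\text{over}\quad -1\le c_1\le\cdots\le c_{2^b}\le 1,$$ where $t_0=-1$, $t_{2^b}=1$ and $t_i=\frac{c_i+c_{i+1}}2$ for $1\le i<2^b$. Let $\Pi$ be a random orthogonal $d\times d$ matrix obtained as the orthogonal factor of the QR decomposition (normalized so that the triangular factor has positive diagonal) of a matrix with i.i.d. $\mathcal N(0,1)$ entries. Given a codebook $c$, a vector $x\in\mathbb R^d$ is quantized to the indices $\mathrm{idx}_j\in\arg\min_k|(\Pi x)_j-c_k|$, $1\le j\le d$ (ties broken by any fixed rule), and the indices are dequantized to $\Pi^{\top}\tilde y$ with $\tilde y_j=c_{\mathrm{idx}_j}$. For parameter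 vectors $f_1,\dots,f_N\in\mathbb R^d$, the norm-separated scheme stores $\gamma_i=\|f_i\|_2$ and the indices of the direction $f_i/\gamma_i$ (read as $0$ if $f_i=0$); the reconstruction $\tilde f_i$ is $\gamma_i$ times the dequantized direction. The same $\Pi$ and $c$ are used for all $i$. Then a Lloyd–Max codebook exists, and for every Lloyd–Max codebook, every tie-breaking rule and every $i$, the squared error $\|f_i-\tilde f_i\|_2^2$ is integrable and $$\mathbb E\left[\|f_i-\tilde f_i\|_2^2\right]\le \gamma_i^2\cdot\frac{\sqrt3\,\pi}{2}\cdot\frac1{4^b}.$$ -/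

import Mathlib

open MeasureTheory ProbabilityTheory

noncomputable section

namespace TurboQuant

/-- Density on `[-1, 1]` of one coordinate of a uniform point of the unit sphere of `ℝ^d`
(a genuine probability density for `2 ≤ d`). -/
def betaDensity (d : ℕ) (x : ℝ) : ℝ :=
  Real.Gamma ((d : ℝ) / 2) / (Real.sqrt Real.pi * Real.Gamma (((d : ℝ) - 1) / 2)) *
    (1 - x ^ 2) ^ (((d : ℝ) - 3) / 2)

/-- Left end of the `i`-th cell: the midpoint with the preceding centroid, or `-1` for the
first cell. -/
def cellLower {n : ℕ} (c : Fin n → ℝ) (i : Fin n) : ℝ :=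
  if i.val = 0 then -1 else (c ⟨i.val - 1, by omega⟩ + c i) / 2

/-- Right end of the `i`-th cell: the midpoint with the next centroid, or `1` for the last
cell. -/
def cellUpper {n : ℕ} (c : Fin n → ℝ) (i : Fin n) : ℝ :=
  if h : i.val + 1 < n then (c i + c ⟨i.val + 1, h⟩) / 2 else 1

/-- Scalar quantization mean squared error of the centroids `c` for the density
`betaDensity d`. -/
def scalarCost (d : ℕ) {n : ℕ} (c : Fin n → ℝ) : ℝ :=
  ∑ i, ∫ x in (cellLower c i)..(cellUpper c i), |x - c i| ^ 2 * betaDensity d x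

/-- Admissible codebooks: `-1 ≤ c_1 ≤ ⋯ ≤ c_n ≤ 1`. -/
def IsCodebook {n : ℕ} (c : Fin n → ℝ) : Prop :=
  Monotone c ∧ ∀ i, c i ∈ Set.Icc (-1 : ℝ) 1

/-- The codebook `c` with `n` centroids is a minimizer of the scalar quantization error. -/
def IsLloydMaxCodebook (d : ℕ) {n : ℕ} (c : Fin n → ℝ) : Prop :=
  IsCodebook c ∧ ∀ c' : Fin n → ℝ, IsCodebook c' → scalarCost d c ≤ scalarCost d c'

/-- `q y ∈ argmin_k |y - c_k|` for every real `y`; ties are broken arbitrarily. -/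
def IsNearestIndex {n : ℕ} (c : Fin n → ℝ) (q : ℝ → Fin n) : Prop :=
  ∀ (y : ℝ) (k : Fin n), |y - c (q y)| ≤ |y - c k|

/-- `Q` is the orthogonal factor of the QR decomposition of `A`, normalized so that the
triangular factor has a positive diagonal. -/
def IsQRFactor {d : ℕ} (A Q : Matrix (Fin d) (Fin d) ℝ) : Prop :=
  Q ∈ Matrix.orthogonalGroup (Fin d) ℝ ∧
    ∃ R : Matrix (Fin d) (Fin d) ℝ,
      R.BlockTriangular id ∧ (∀ i, 0 < R i i) ∧ A = Q * R

/-- `Q` is a random rotation: almost surely the orthogonal factor of the QR decomposition of a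
matrix with independent standard Gaussian entries. -/
def IsRandomRotation {Ω : Type*} [MeasurableSpace Ω] (P : Measure Ω) {d : ℕ}
    (Q : Ω → Matrix (Fin d) (Fin d) ℝ) : Prop :=
  ∃ G : Ω → Matrix (Fin d) (Fin d) ℝ,
    (∀ i j, HasLaw (fun ω => G ω i j) (gaussianReal 0 1) P) ∧
    iIndepFun (fun (p : Fin d × Fin d) (ω : Ω) => G ω p.1 p.2) P ∧
    ∀ᵐ ω ∂P, IsQRFactor (G ω) (Q ω)

/-- Rotate by `Q`, then replace each coordinate by the index of its nearest centroid. -/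
def quantize {d n : ℕ} (Q : Matrix (Fin d) (Fin d) ℝ) (q : ℝ → Fin n)
    (x : EuclideanSpace ℝ (Fin d)) : Fin d → Fin n :=
  fun j => q ((Q.mulVec (fun i => x i)) j)

/-- Look up the centroids and rotate back by the transpose of `Q`. -/
def dequantize {d n : ℕ} (Q : Matrix (Fin d) (Fin d) ℝ) (c : Fin n → ℝ)
    (idx : Fin d → Fin n) : EuclideanSpace ℝ (Fin d) :=
  WithLp.toLp 2 (Q.transpose.mulVec (fun j => c (idx j)))

/-- Stored data: the norm of `f` and the indices of its direction `f / ‖f‖`. -/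
def encode {d n : ℕ} (Q : Matrix (Fin d) (Fin d) ℝ) (q : ℝ → Fin n)
    (f : EuclideanSpace ℝ (Fin d)) : ℝ × (Fin d → Fin n) :=
  (‖f‖, quantize Q q (‖f‖⁻¹ • f))

/-- Reconstruction from stored data: the dequantized direction, rescaled by the norm. -/
def decode {d n : ℕ} (Q : Matrix (Fin d) (Fin d) ℝ) (c : Fin n → ℝ)
    (s : ℝ × (Fin d → Fin n)) : EuclideanSpace ℝ (Fin d) :=
  s.1 • dequantize Q c s.2

end TurboQuant

end

/-!
A rotation carries the direction of `f i` to a unit vector `y` whose coordinates all have density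
`betaDensity d`. Rotating back is an isometry, so the expected squared error is `‖f i‖ ^ 2` times
`d` times the scalar quantization error of the codebook for that density. It remains to find, for
every number `n` of centroids, one codebook whose scalar error is at most `√3 π / (2 d n ^ 2)`;
a Lloyd–Max codebook does at least as well, and one exists by compactness and continuity.

*The codebook.* For `d = 2` uniform cells suffice, since the error is at most `1 / n ^ 2`. For
`3 ≤ d` the density is a constant times `h ^ 3`, where `h = (1 - x ^ 2) ^ p` with `p = (d - 3) / 6`
is log-concave. Cut `[-1, 1]` into `n` cells with equal integrals of `h`, and let each centroid `m`
halve the integral of its cell. Put `H x = ∫ y in m..x, h y`. Log-concavity is used twice. First,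
`h` is a concave function of `H`, so `h x ≤ h m * (1 - κ * H x)` for some `κ`
(`weight_le_tangent`). Second, the average of `h` over `[m, x]` is at least `√(h m * h x)`
(`sq_mul_weight_mul_weight_le`). Together
`(x - m) ^ 2 * h x ^ 2 ≤ H x ^ 2 * (1 - κ * H x)`. Multiplied by `h = H'`, the right side has
primitive `H ^ 3 / 3 - κ * H ^ 4 / 4`. As `H` takes opposite values at the two ends of the cell, the
term in `κ` cancels, and the error of a cell is at most `(∫ h) ^ 3 / 12` (`integral_cell_le`).
Summed over the cells this is the Panter–Dite value `(∫ h) ^ 3 / (12 n ^ 2)`, without any error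
term. The integral is a Beta integral, and `Γ (y + 1 / 2) ^ 2 ≤ y * Γ y ^ 2`, applied twice, gives
the constant (`mul_densityConst_mul_integral_cube_le`).

*The law of a coordinate.* By uniqueness of the QR decomposition the orthogonal factor is
almost surely the result of the Gram–Schmidt process, which is measurable and commutes with
isometries. The law of a Gaussian matrix is invariant under rotations of its columns, hence `y` is
rotation-invariant (`map_rotated_stdGaussian`). Averaging `φ (⟪e, y⟫ / ‖e‖)` over `y` and over an
independent vector `e` with weight `exp (-‖e‖ ^ 2)`, in the two possible orders, expresses the law
of a coordinate of `y` by a Gaussian integral (`lintegral_coord_of_rotationInvariant`), which polar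
coordinates in the last `d - 1` coordinates and the substitution `x = r * s / √(1 - s ^ 2)`
evaluate.
-/

noncomputable section

namespace TurboQuant

/-! ### The weights `(1 - x ^ 2) ^ p` and their integrals -/

lemma integral_rpow_mul_one_sub_rpow {p : ℝ} (hp : -1 < p) :
    ∫ t in (0 : ℝ)..1, t ^ p * (1 - t) ^ p = beta (p + 1) (p + 1) := by
  have hp' : 0 < p + 1 := by linarith
  rw [beta_eq_betaIntegralReal _ _ hp' hp', Complex.betaIntegral,
    ← Complex.ofReal_re (∫ t in (0 : ℝ)..1, t ^ p * (1 - t) ^ p), ← intervalIntegral.integral_ofReal]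
  congr 1
  refine intervalIntegral.integral_congr fun t ht => ?_
  rw [Set.uIcc_of_le zero_le_one] at ht
  push_cast
  rw [Complex.ofReal_cpow ht.1, Complex.ofReal_cpow (sub_nonneg.2 ht.2)]
  push_cast
  simp

/-- The substitution `x = 2 t - 1` turns the integral into a Beta integral, and Legendre's
duplication formula simplifies its value. -/
lemma integral_one_sub_sq_rpow {p : ℝ} (hp : -1 < p) :
    ∫ x in (-1 : ℝ)..1, (1 - x ^ 2) ^ p =
      Real.sqrt Real.pi * Real.Gamma (p + 1) / Real.Gamma (p + 3 / 2) := by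
  have hsub := intervalIntegral.mul_integral_comp_mul_sub (a := 0) (b := 1)
    (f := fun x : ℝ => (1 - x ^ 2) ^ p) (c := 2) (d := 1)
  have hcongr : ∫ t in (0 : ℝ)..1, (1 - (2 * t - 1) ^ 2) ^ p =
      ∫ t in (0 : ℝ)..1, 4 ^ p * (t ^ p * (1 - t) ^ p) := by
    refine intervalIntegral.integral_congr fun t ht => ?_
    rw [Set.uIcc_of_le zero_le_one] at ht
    have h1 : 0 ≤ 1 - t := sub_nonneg.2 ht.2
    rw [← Real.mul_rpow ht.1 h1, ← Real.mul_rpow (by norm_num) (mul_nonneg ht.1 h1)]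
    congr 1
    ring
  rw [hcongr, intervalIntegral.integral_const_mul, integral_rpow_mul_one_sub_rpow hp] at hsub
  norm_num at hsub
  rw [← hsub, beta]
  have hdup := Real.Gamma_mul_Gamma_add_half (p + 1)
  have g1 : 0 < Real.Gamma (p + 1) := Real.Gamma_pos_of_pos (by linarith)
  have g2 : 0 < Real.Gamma (p + 3 / 2) := Real.Gamma_pos_of_pos (by linarith)
  have g3 : 0 < Real.Gamma (p + 1 + (p + 1)) := Real.Gamma_pos_of_pos (by linarith)
  rw [show p + 1 + 1 / 2 = p + 3 / 2 by ring, show 2 * (p + 1) = p + 1 + (p + 1) by ring] at hdup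
  have h4 : 2 * (4 : ℝ) ^ p * 2 ^ (1 - (p + 1 + (p + 1))) = 1 := by
    rw [show (4 : ℝ) = 2 ^ (2 : ℝ) by norm_num, ← Real.rpow_mul (by norm_num)]
    nth_rewrite 1 [← Real.rpow_one 2]
    rw [← Real.rpow_add (by norm_num), ← Real.rpow_add (by norm_num)]
    ring_nf
    simp
  generalize Real.Gamma (p + 1 + (p + 1)) = a at *
  generalize Real.Gamma (p + 3 / 2) = b at *
  generalize Real.Gamma (p + 1) = c at *
  field_simp
  linear_combination (2 * 4 ^ p) * hdup + a * Real.sqrt Real.pi * h4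

lemma intervalIntegrable_one_sub_sq_rpow {p : ℝ} (hp : -1 < p) :
    IntervalIntegrable (fun x : ℝ => (1 - x ^ 2) ^ p) volume (-1) 1 := by
  refine intervalIntegral.intervalIntegrable_of_integral_ne_zero ?_
  rw [integral_one_sub_sq_rpow hp]
  have g1 : 0 < Real.Gamma (p + 1) := Real.Gamma_pos_of_pos (by linarith)
  have g2 : 0 < Real.Gamma (p + 3 / 2) := Real.Gamma_pos_of_pos (by linarith)
  have := Real.pi_pos
  positivity

/-- The normalizing constant of `betaDensity d`. -/
def densityConst (d : ℕ) : ℝ :=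
  Real.Gamma ((d : ℝ) / 2) / (Real.sqrt Real.pi * Real.Gamma (((d : ℝ) - 1) / 2))

lemma betaDensity_eq (d : ℕ) (x : ℝ) :
    betaDensity d x = densityConst d * (1 - x ^ 2) ^ (((d : ℝ) - 3) / 2) := rfl

lemma densityConst_pos {d : ℕ} (hd : 2 ≤ d) : 0 < densityConst d := by
  have hd' : (2 : ℝ) ≤ d := by exact_mod_cast hd
  have g1 : 0 < Real.Gamma ((d : ℝ) / 2) := Real.Gamma_pos_of_pos (by linarith)
  have g2 : 0 < Real.Gamma (((d : ℝ) - 1) / 2) := Real.Gamma_pos_of_pos (by linarith)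
  have := Real.pi_pos
  rw [densityConst]
  positivity

lemma betaDensity_nonneg {d : ℕ} (hd : 2 ≤ d) {x : ℝ} (hx : x ∈ Set.Icc (-1 : ℝ) 1) :
    0 ≤ betaDensity d x :=
  mul_nonneg (densityConst_pos hd).le (Real.rpow_nonneg (by nlinarith [hx.1, hx.2]) _)

lemma measurable_betaDensity (d : ℕ) : Measurable (betaDensity d) := by
  unfold betaDensity
  fun_prop

lemma intervalIntegrable_betaDensity {d : ℕ} (hd : 2 ≤ d) :
    IntervalIntegrable (betaDensity d) volume (-1) 1 := by
  have hd' : (2 : ℝ) ≤ d := by exact_mod_cast hd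
  exact (intervalIntegrable_one_sub_sq_rpow (by linarith)).const_mul _

lemma integral_betaDensity {d : ℕ} (hd : 2 ≤ d) : ∫ x in (-1 : ℝ)..1, betaDensity d x = 1 := by
  have hd' : (2 : ℝ) ≤ d := by exact_mod_cast hd
  have g1 : 0 < Real.Gamma ((d : ℝ) / 2) := Real.Gamma_pos_of_pos (by linarith)
  have g2 : 0 < Real.Gamma (((d : ℝ) - 1) / 2) := Real.Gamma_pos_of_pos (by linarith)
  have := Real.pi_pos
  simp_rw [betaDensity]
  rw [intervalIntegral.integral_const_mul, integral_one_sub_sq_rpow (by linarith),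
    show ((d : ℝ) - 3) / 2 + 1 = (d - 1) / 2 by ring,
    show ((d : ℝ) - 3) / 2 + 3 / 2 = d / 2 by ring]
  field_simp

/-! ### The distortion constant -/

lemma Gamma_add_half_sq_le {y : ℝ} (hy : 0 < y) :
    Real.Gamma (y + 1 / 2) ^ 2 ≤ y * Real.Gamma y ^ 2 := by
  have h := Real.Gamma_mul_add_mul_le_rpow_Gamma_mul_rpow_Gamma (s := y) (t := y + 1)
    (a := 1 / 2) (b := 1 / 2) hy (by linarith) (by norm_num) (by norm_num) (by norm_num)
  have g := Real.Gamma_pos_of_pos hy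
  rw [show 1 / 2 * y + 1 / 2 * (y + 1) = y + 1 / 2 by ring, Real.Gamma_add_one hy.ne',
    ← Real.sqrt_eq_rpow, ← Real.sqrt_eq_rpow] at h
  have h0 : 0 ≤ Real.Gamma (y + 1 / 2) := (Real.Gamma_pos_of_pos (by linarith)).le
  calc Real.Gamma (y + 1 / 2) ^ 2
      ≤ (Real.sqrt (Real.Gamma y) * Real.sqrt (y * Real.Gamma y)) ^ 2 := by gcongr
    _ = y * Real.Gamma y ^ 2 := by
      rw [mul_pow, Real.sq_sqrt g.le, Real.sq_sqrt (by positivity)]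
      ring

/-- The Panter–Dite constant of `betaDensity d`, multiplied by `d`, is at most that of the standard
Gaussian, its limit for `d → ∞`. -/
lemma mul_densityConst_mul_integral_cube_le {d : ℕ} (hd : 2 ≤ d) :
    d * (densityConst d * (∫ x in (-1 : ℝ)..1, (1 - x ^ 2) ^ (((d : ℝ) - 3) / 6)) ^ 3 / 12) ≤
      Real.sqrt 3 * Real.pi / 2 := by
  have hd' : (2 : ℝ) ≤ d := by exact_mod_cast hd
  rw [densityConst]
  generalize (d : ℝ) = D at *
  have hD : 0 < D := by linarith
  rw [integral_one_sub_sq_rpow (by linarith)]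
  rw [show (D - 3) / 6 + 1 = D / 6 + 1 / 2 by ring, show (D - 3) / 6 + 3 / 2 = D / 6 + 1 by ring,
    Real.Gamma_add_one (by positivity)]
  have h1 := Gamma_add_half_sq_le (y := (D - 1) / 2) (by linarith)
  have h2 := Gamma_add_half_sq_le (y := D / 6) (by linarith)
  rw [show (D - 1) / 2 + 1 / 2 = D / 2 by ring] at h1
  have a1 : 0 < Real.Gamma ((D - 1) / 2) := Real.Gamma_pos_of_pos (by linarith)
  have a2 : 0 < Real.Gamma (D / 2) := Real.Gamma_pos_of_pos (by linarith)
  have a3 : 0 < Real.Gamma (D / 6) := Real.Gamma_pos_of_pos (by linarith)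
  have a4 : 0 < Real.Gamma (D / 6 + 1 / 2) := Real.Gamma_pos_of_pos (by linarith)
  set A := Real.Gamma ((D - 1) / 2)
  set B := Real.Gamma (D / 2)
  set C := Real.Gamma (D / 6)
  set E := Real.Gamma (D / 6 + 1 / 2)
  have hpi := Real.pi_pos
  have h1' : B / A ≤ Real.sqrt (D / 2) := by
    apply Real.le_sqrt_of_sq_le
    rw [div_pow, div_le_iff₀ (by positivity)]
    nlinarith [sq_nonneg A]
  have h2' : E / C ≤ Real.sqrt (D / 6) := by
    apply Real.le_sqrt_of_sq_le
    rw [div_pow, div_le_iff₀ (by positivity)]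
    exact h2
  have hs : Real.sqrt (D / 2) = Real.sqrt 3 * Real.sqrt (D / 6) := by
    rw [← Real.sqrt_mul (by norm_num)]
    congr 1
    ring
  have hsq := Real.sq_sqrt (show 0 ≤ D / 6 by positivity)
  calc D * (B / (Real.sqrt Real.pi * A) * (Real.sqrt Real.pi * E / (D / 6 * C)) ^ 3 / 12)
      = (Real.sqrt Real.pi) ^ 2 * (D * (B / A) * (E / C) ^ 3 / (12 * (D / 6) ^ 3)) := by
        field_simp
    _ ≤ (Real.sqrt Real.pi) ^ 2 *
          (D * (Real.sqrt (D / 2)) * (Real.sqrt (D / 6)) ^ 3 / (12 * (D / 6) ^ 3)) := by gcongr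
    _ = Real.sqrt 3 * Real.pi / 2 := by
        rw [Real.sq_sqrt hpi.le, hs,
          show D * (Real.sqrt 3 * Real.sqrt (D / 6)) * Real.sqrt (D / 6) ^ 3
            = D * Real.sqrt 3 * (Real.sqrt (D / 6) ^ 2) ^ 2 by ring, hsq]
        field_simp
        norm_num

/-! ### One cell of the companding quantizer -/

lemma continuous_one_sub_sq_rpow {p : ℝ} (hp : 0 ≤ p) :
    Continuous fun x : ℝ => (1 - x ^ 2) ^ p :=
  (by fun_prop : Continuous fun x : ℝ => 1 - x ^ 2).rpow_const fun _ => Or.inr hp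

lemma one_sub_sq_nonneg {x : ℝ} (hx : x ∈ Set.Icc (-1 : ℝ) 1) : 0 ≤ 1 - x ^ 2 := by
  nlinarith [hx.1, hx.2]

lemma one_sub_sq_pos {x : ℝ} (hx : x ∈ Set.Ioo (-1 : ℝ) 1) : 0 < 1 - x ^ 2 := by
  nlinarith [hx.1, hx.2]

lemma hasDerivAt_one_sub_sq_rpow (p : ℝ) {x : ℝ} (hx : x ∈ Set.Ioo (-1 : ℝ) 1) :
    HasDerivAt (fun x : ℝ => (1 - x ^ 2) ^ p) (-(2 * p * x / (1 - x ^ 2)) * (1 - x ^ 2) ^ p) x := by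
  have hx' := one_sub_sq_pos hx
  have h : HasDerivAt (fun x : ℝ => 1 - x ^ 2) (-(2 * x)) x := by
    simpa using (hasDerivAt_pow 2 x).const_sub 1
  refine (h.rpow_const (p := p) (Or.inl hx'.ne')).congr_deriv ?_
  rw [Real.rpow_sub_one hx'.ne']
  ring

/-- The logarithmic derivative of `(1 - x ^ 2) ^ p` is antitone. -/
lemma logDeriv_weight_mono {p : ℝ} (hp : 0 ≤ p) {x y : ℝ} (hx : x ∈ Set.Ioo (-1 : ℝ) 1)
    (hy : y ∈ Set.Ioo (-1 : ℝ) 1) (hxy : x ≤ y) :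
    2 * p * x / (1 - x ^ 2) ≤ 2 * p * y / (1 - y ^ 2) := by
  rw [div_le_div_iff₀ (one_sub_sq_pos hx) (one_sub_sq_pos hy)]
  have h1 : 0 ≤ 1 + x * y := by nlinarith [hx.1, hx.2, hy.1, hy.2]
  have h2 := mul_nonneg hp (mul_nonneg (sub_nonneg.2 hxy) h1)
  nlinarith

/-- Since `h = (1 - x ^ 2) ^ p` is log-concave, it is a concave function of its own primitive
`∫ h`; this is the tangent line bound at `m`. -/
lemma weight_le_tangent {p : ℝ} (hp : 0 ≤ p) {m x : ℝ} (hm : m ∈ Set.Ioo (-1 : ℝ) 1)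
    (hx : x ∈ Set.Ioo (-1 : ℝ) 1) :
    (1 - x ^ 2) ^ p ≤ (1 - m ^ 2) ^ p
      - 2 * p * m / (1 - m ^ 2) * ∫ y in m..x, (1 - y ^ 2) ^ p := by
  have hcont := continuous_one_sub_sq_rpow hp
  set D : ℝ → ℝ := fun z => (1 - m ^ 2) ^ p
      - 2 * p * m / (1 - m ^ 2) * (∫ y in m..z, (1 - y ^ 2) ^ p) - (1 - z ^ 2) ^ p with hD
  have hDm : D m = 0 := by simp [hD]
  have hderiv : ∀ z ∈ Set.Ioo (-1 : ℝ) 1, HasDerivAt D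
      ((2 * p * z / (1 - z ^ 2) - 2 * p * m / (1 - m ^ 2)) * (1 - z ^ 2) ^ p) z := by
    intro z hz
    have h1 : HasDerivAt (fun z => ∫ y in m..z, (1 - y ^ 2) ^ p) ((1 - z ^ 2) ^ p) z :=
      hcont.integral_hasStrictDerivAt m z |>.hasDerivAt
    refine (((h1.const_mul (2 * p * m / (1 - m ^ 2))).const_sub ((1 - m ^ 2) ^ p)).sub
      (hasDerivAt_one_sub_sq_rpow p hz)).congr_deriv ?_
    ring
  suffices h : 0 ≤ D x by
    simp only [hD] at h
    linarith
  rcases le_total m x with hmx | hxm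
  · have hsub : Set.Icc m x ⊆ Set.Ioo (-1) 1 := Set.Icc_subset_Ioo hm.1 hx.2
    have hmono : MonotoneOn D (Set.Icc m x) := by
      refine monotoneOn_of_deriv_nonneg (convex_Icc _ _)
        (fun z hz => (hderiv z (hsub hz)).continuousAt.continuousWithinAt)
        (fun z hz => (hderiv z (hsub (interior_subset hz))).differentiableAt.differentiableWithinAt)
        fun z hz => ?_
      have hz' := interior_subset hz
      rw [(hderiv z (hsub hz')).deriv]
      exact mul_nonneg (sub_nonneg.2 (logDeriv_weight_mono hp hm (hsub hz') hz'.1))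
        (Real.rpow_nonneg (one_sub_sq_pos (hsub hz')).le _)
    rw [← hDm]
    exact hmono (Set.left_mem_Icc.2 hmx) (Set.right_mem_Icc.2 hmx) hmx
  · have hsub : Set.Icc x m ⊆ Set.Ioo (-1) 1 := Set.Icc_subset_Ioo hx.1 hm.2
    have hanti : AntitoneOn D (Set.Icc x m) := by
      refine antitoneOn_of_deriv_nonpos (convex_Icc _ _)
        (fun z hz => (hderiv z (hsub hz)).continuousAt.continuousWithinAt)
        (fun z hz => (hderiv z (hsub (interior_subset hz))).differentiableAt.differentiableWithinAt)
        fun z hz => ?_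
      have hz' := interior_subset hz
      rw [(hderiv z (hsub hz')).deriv]
      exact mul_nonpos_of_nonpos_of_nonneg
        (sub_nonpos.2 (logDeriv_weight_mono hp (hsub hz') hm hz'.2))
        (Real.rpow_nonneg (one_sub_sq_pos (hsub hz')).le _)
    rw [← hDm]
    exact hanti (Set.left_mem_Icc.2 hxm) (Set.right_mem_Icc.2 hxm) hxm

lemma weight_mul_reflect_ge {p : ℝ} (hp : 0 ≤ p) {m x y : ℝ} (hm : m ∈ Set.Icc (-1 : ℝ) 1)
    (hx : x ∈ Set.Icc (-1 : ℝ) 1) (hy : y ∈ Set.Icc m x) :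
    (1 - m ^ 2) ^ p * (1 - x ^ 2) ^ p ≤ (1 - y ^ 2) ^ p * (1 - (m + x - y) ^ 2) ^ p := by
  have hy1 : y ∈ Set.Icc (-1 : ℝ) 1 := ⟨hm.1.trans hy.1, hy.2.trans hx.2⟩
  have hy2 : m + x - y ∈ Set.Icc (-1 : ℝ) 1 :=
    ⟨by linarith [hm.1, hy.2], by linarith [hx.2, hy.1]⟩
  rw [← Real.mul_rpow (one_sub_sq_nonneg hm) (one_sub_sq_nonneg hx),
    ← Real.mul_rpow (one_sub_sq_nonneg hy1) (one_sub_sq_nonneg hy2)]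
  refine Real.rpow_le_rpow (mul_nonneg (one_sub_sq_nonneg hm) (one_sub_sq_nonneg hx)) ?_ hp
  -- `(1 - s ^ 2) * (1 - t ^ 2) = (1 + s * t) ^ 2 - (s + t) ^ 2` grows with the product `s * t`.
  have h1 : m * x ≤ y * (m + x - y) := by
    nlinarith [mul_nonneg (sub_nonneg.2 hy.1) (sub_nonneg.2 hy.2)]
  have h2 : -1 ≤ m * x := by nlinarith [hm.1, hm.2, hx.1, hx.2]
  nlinarith [mul_nonneg (sub_nonneg.2 h1)
    (by linarith : 0 ≤ 2 + m * x + y * (m + x - y))]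

/-- The average of a log-concave function over an interval is at least the geometric mean of its
values at the end points. -/
lemma sq_mul_weight_mul_weight_le {p : ℝ} (hp : 0 ≤ p) {m x : ℝ} (hm : m ∈ Set.Icc (-1 : ℝ) 1)
    (hx : x ∈ Set.Icc (-1 : ℝ) 1) :
    (x - m) ^ 2 * ((1 - m ^ 2) ^ p * (1 - x ^ 2) ^ p) ≤ (∫ y in m..x, (1 - y ^ 2) ^ p) ^ 2 := by
  wlog hmx : m ≤ x generalizing m x
  · have := this hx hm (le_of_not_ge hmx)
    rw [intervalIntegral.integral_symm, neg_sq]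
    linarith
  have hcont := continuous_one_sub_sq_rpow hp
  set g := Real.sqrt ((1 - m ^ 2) ^ p * (1 - x ^ 2) ^ p) with hg
  have hg2 : g ^ 2 = (1 - m ^ 2) ^ p * (1 - x ^ 2) ^ p :=
    Real.sq_sqrt (mul_nonneg (Real.rpow_nonneg (one_sub_sq_nonneg hm) _)
      (Real.rpow_nonneg (one_sub_sq_nonneg hx) _))
  have hrefl : ∫ y in m..x, (1 - (m + x - y) ^ 2) ^ p = ∫ y in m..x, (1 - y ^ 2) ^ p := by
    rw [intervalIntegral.integral_comp_sub_left (fun y => (1 - y ^ 2) ^ p)]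
    congr 1 <;> ring
  have hint1 : IntervalIntegrable (fun y : ℝ => (1 - y ^ 2) ^ p) volume m x :=
    hcont.intervalIntegrable _ _
  have hint2 : IntervalIntegrable (fun y : ℝ => (1 - (m + x - y) ^ 2) ^ p) volume m x :=
    (hcont.comp (by fun_prop : Continuous fun y : ℝ => m + x - y)).intervalIntegrable _ _
  have hle : ∫ _ in m..x, 2 * g ≤
      ∫ y in m..x, ((1 - y ^ 2) ^ p + (1 - (m + x - y) ^ 2) ^ p) := by
    refine intervalIntegral.integral_mono_on hmx (by simp) (hint1.add hint2) fun y hy => ?_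
    have hy1 : y ∈ Set.Icc (-1 : ℝ) 1 := ⟨hm.1.trans hy.1, hy.2.trans hx.2⟩
    have hy2 : m + x - y ∈ Set.Icc (-1 : ℝ) 1 :=
      ⟨by linarith [hm.1, hy.2], by linarith [hx.2, hy.1]⟩
    have h0 := weight_mul_reflect_ge hp hm hx hy
    rw [← hg2] at h0
    have h1 := Real.rpow_nonneg (one_sub_sq_nonneg hy1) p
    have h2 := Real.rpow_nonneg (one_sub_sq_nonneg hy2) p
    -- The arithmetic mean of the values at `y` and its mirror image is at least the geometric one.
    refine abs_le_of_sq_le_sq' ?_ (by positivity) |>.2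
    nlinarith [sq_nonneg ((1 - y ^ 2) ^ p - (1 - (m + x - y) ^ 2) ^ p)]
  rw [intervalIntegral.integral_add hint1 hint2, hrefl, intervalIntegral.integral_const,
    smul_eq_mul] at hle
  rw [← hg2, ← mul_pow]
  have hg0 : 0 ≤ g := Real.sqrt_nonneg _
  exact pow_le_pow_left₀ (mul_nonneg (sub_nonneg.2 hmx) hg0) (by linarith) 2

/-- Cell inequality: if `m` halves the `h`-mass of the cell `[a, b]`, where `h = (1 - x ^ 2) ^ p`,
then `∫ (x - m) ^ 2 * h ^ 3` over the cell is at most `(∫ h) ^ 3 / 12`, which is its value when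
`h` is constant. -/
lemma integral_cell_le {p : ℝ} (hp : 0 ≤ p) {a m b δ : ℝ} (hab : a ≤ b) (ha : -1 ≤ a) (hb : b ≤ 1)
    (hm : m ∈ Set.Ioo (-1 : ℝ) 1) (hma : ∫ y in a..m, (1 - y ^ 2) ^ p = δ)
    (hmb : ∫ y in m..b, (1 - y ^ 2) ^ p = δ) :
    ∫ x in a..b, (x - m) ^ 2 * ((1 - x ^ 2) ^ p) ^ 3 ≤ 2 * δ ^ 3 / 3 := by
  have hcont := continuous_one_sub_sq_rpow hp
  set F : ℝ → ℝ := fun z => ∫ y in m..z, (1 - y ^ 2) ^ p with hF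
  have hFd : ∀ z, HasDerivAt F ((1 - z ^ 2) ^ p) z := fun z =>
    (hcont.integral_hasStrictDerivAt m z).hasDerivAt
  have hFc : Continuous F := continuous_iff_continuousAt.2 fun z => (hFd z).continuousAt
  have hFa : F a = -δ := by rw [hF, ← hma]; exact intervalIntegral.integral_symm _ _
  have hFb : F b = δ := hmb
  have hm0 : 0 < (1 - m ^ 2) ^ p := Real.rpow_pos_of_pos (one_sub_sq_pos hm) _
  set κ := 2 * p * m / (1 - m ^ 2) / (1 - m ^ 2) ^ p with hκ
  have hprim : ∫ x in a..b, (F x ^ 2 - κ * F x ^ 3) * (1 - x ^ 2) ^ p = 2 * δ ^ 3 / 3 := by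
    have := intervalIntegral.integral_eq_sub_of_hasDerivAt (a := a) (b := b)
      (f := fun x => F x ^ 3 / 3 - κ * (F x ^ 4 / 4))
      (f' := fun x => (F x ^ 2 - κ * F x ^ 3) * (1 - x ^ 2) ^ p)
      (fun x _ => by
        refine ((((hFd x).pow 3).div_const 3).sub
          ((((hFd x).pow 4).div_const 4).const_mul κ)).congr_deriv ?_
        push_cast
        ring)
      (Continuous.intervalIntegrable (by fun_prop) _ _)
    rw [this, hFa, hFb]
    ring
  rw [← hprim]
  refine intervalIntegral.integral_mono_on_of_le_Ioo hab
    (Continuous.intervalIntegrable (by fun_prop) _ _)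
    (Continuous.intervalIntegrable (by fun_prop) _ _) fun x hx => ?_
  have hx' : x ∈ Set.Ioo (-1 : ℝ) 1 := ⟨ha.trans_lt hx.1, hx.2.trans_le hb⟩
  have hx0 : 0 < (1 - x ^ 2) ^ p := Real.rpow_pos_of_pos (one_sub_sq_pos hx') _
  have h1 : (1 - x ^ 2) ^ p ≤ (1 - m ^ 2) ^ p * (1 - κ * F x) := by
    have h := weight_le_tangent hp hm hx'
    have e : (1 - m ^ 2) ^ p * κ = 2 * p * m / (1 - m ^ 2) := by
      rw [hκ]; field_simp
    calc _ ≤ _ := h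
      _ = (1 - m ^ 2) ^ p * (1 - κ * F x) := by rw [← e]; ring
  have h2 : (x - m) ^ 2 * ((1 - m ^ 2) ^ p * (1 - x ^ 2) ^ p) ≤ F x ^ 2 :=
    sq_mul_weight_mul_weight_le hp (Set.Ioo_subset_Icc_self hm) (Set.Ioo_subset_Icc_self hx')
  have h3 : 0 ≤ 1 - κ * F x := by
    by_contra! hneg
    nlinarith [mul_neg_of_pos_of_neg hm0 hneg]
  generalize (1 - x ^ 2) ^ p = u at *
  generalize (1 - m ^ 2) ^ p = v at *
  calc (x - m) ^ 2 * u ^ 3 = (x - m) ^ 2 * u * u * u := by ring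
    _ ≤ (x - m) ^ 2 * u * (v * (1 - κ * F x)) * u := by gcongr
    _ = ((x - m) ^ 2 * (v * u)) * (1 - κ * F x) * u := by ring
    _ ≤ F x ^ 2 * (1 - κ * F x) * u := by gcongr
    _ = (F x ^ 2 - κ * F x ^ 3) * u := by ring

/-! ### The quantization error as an integral of the squared distance to the codebook -/

/-- Squared distance from `x` to the nearest centroid of `c`. -/
def minSq {n : ℕ} [NeZero n] (c : Fin n → ℝ) (x : ℝ) : ℝ :=
  Finset.univ.inf' Finset.univ_nonempty fun k => (x - c k) ^ 2

section

variable {n : ℕ} [NeZero n]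

lemma minSq_le (c : Fin n → ℝ) (x : ℝ) (k : Fin n) : minSq c x ≤ (x - c k) ^ 2 :=
  Finset.inf'_le _ (Finset.mem_univ k)

lemma minSq_nonneg (c : Fin n → ℝ) (x : ℝ) : 0 ≤ minSq c x :=
  Finset.le_inf' _ _ fun _ _ => sq_nonneg _

lemma minSq_eq {c : Fin n → ℝ} {x : ℝ} {i : Fin n} (h : ∀ k, (x - c i) ^ 2 ≤ (x - c k) ^ 2) :
    minSq c x = (x - c i) ^ 2 :=
  le_antisymm (minSq_le c x i) (Finset.le_inf' _ _ fun k _ => h k)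

lemma continuous_minSq : Continuous fun y : (Fin n → ℝ) × ℝ => minSq y.1 y.2 :=
  Continuous.finset_inf'_apply _ fun k _ => by fun_prop

lemma continuous_minSq_right (c : Fin n → ℝ) : Continuous (minSq c) :=
  continuous_minSq.comp (Continuous.prodMk_right c)

lemma minSq_le_four {c : Fin n → ℝ} (hc : ∀ i, c i ∈ Set.Icc (-1 : ℝ) 1) {x : ℝ}
    (hx : x ∈ Set.Icc (-1 : ℝ) 1) : minSq c x ≤ 4 :=
  (minSq_le c x 0).trans (by nlinarith [(hc 0).1, (hc 0).2, hx.1, hx.2])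

lemma IsNearestIndex.sq_eq_minSq {c : Fin n → ℝ} {q : ℝ → Fin n} (hq : IsNearestIndex c q)
    (y : ℝ) : (y - c (q y)) ^ 2 = minSq c y :=
  (minSq_eq fun k => sq_le_sq.2 (hq y k)).symm

lemma intervalIntegrable_mul_betaDensity {d : ℕ} (hd : 2 ≤ d) {g : ℝ → ℝ} (hg : Continuous g)
    {a b : ℝ} (ha : a ∈ Set.Icc (-1 : ℝ) 1) (hb : b ∈ Set.Icc (-1 : ℝ) 1) :
    IntervalIntegrable (fun x => g x * betaDensity d x) volume a b := by
  refine ((intervalIntegrable_betaDensity hd).mono_set ?_).continuousOn_mul hg.continuousOn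
  rw [Set.uIcc_of_le (by norm_num : (-1 : ℝ) ≤ 1)]
  exact Set.uIcc_subset_Icc ha hb

/-- Any partition of `[-1, 1]` into cells labelled by the centroids bounds the error from above. -/
lemma integral_minSq_le_sum {d : ℕ} (hd : 2 ≤ d) (c : Fin n → ℝ) {a : ℕ → ℝ}
    (h0 : a 0 = -1) (hn : a n = 1) (ha : ∀ k ≤ n, a k ∈ Set.Icc (-1 : ℝ) 1)
    (hmono : ∀ k < n, a k ≤ a (k + 1)) :
    ∫ x in (-1 : ℝ)..1, minSq c x * betaDensity d x ≤
      ∑ i : Fin n, ∫ x in (a i)..(a (i + 1)), (x - c i) ^ 2 * betaDensity d x := by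
  rw [← h0, ← hn, ← intervalIntegral.sum_integral_adjacent_intervals fun k hk =>
    intervalIntegrable_mul_betaDensity hd (continuous_minSq_right c) (ha k hk.le) (ha (k + 1) hk),
    ← Fin.sum_univ_eq_sum_range]
  refine Finset.sum_le_sum fun i _ => ?_
  have h1 := ha i i.2.le
  have h2 := ha (i + 1) i.2
  refine intervalIntegral.integral_mono_on (hmono i i.2)
    (intervalIntegrable_mul_betaDensity hd (continuous_minSq_right c) h1 h2)
    (intervalIntegrable_mul_betaDensity hd (by fun_prop) h1 h2) fun x hx => ?_
  exact mul_le_mul_of_nonneg_right (minSq_le c x i)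
    (betaDensity_nonneg hd ⟨h1.1.trans hx.1, hx.2.trans h2.2⟩)

/-- For an ordered codebook, the cells of `scalarCost` are the Voronoi cells of the centroids. -/
lemma scalarCost_eq {d : ℕ} (hd : 2 ≤ d) {c : Fin n → ℝ} (hc : IsCodebook c) :
    scalarCost d c = ∫ x in (-1 : ℝ)..1, minSq c x * betaDensity d x := by
  obtain ⟨hmono, hmem⟩ := hc
  have hn : 0 < n := Nat.pos_of_ne_zero (NeZero.ne n)
  set t : ℕ → ℝ := fun k => if h : k < n then cellLower c ⟨k, h⟩ else 1 with ht
  have ht0 : t 0 = -1 := by simp [ht, hn, cellLower]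
  have htn : t n = 1 := by simp [ht]
  have hlow : ∀ i : Fin n, cellLower c i = t i := fun i => by simp [ht]
  have hup : ∀ i : Fin n, cellUpper c i = t (i + 1) := fun i => by
    by_cases h : i.val + 1 < n <;> simp [ht, h, cellUpper, cellLower]
  have htmem : ∀ k ≤ n, t k ∈ Set.Icc (-1 : ℝ) 1 := by
    intro k _
    by_cases h : k < n
    · simp only [ht, h, dif_pos, cellLower]
      split_ifs with h0
      · norm_num
      · have h1 := hmem ⟨k - 1, by omega⟩
        have h2 := hmem ⟨k, h⟩
        constructor <;> linarith [h1.1, h1.2, h2.1, h2.2]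
    · simp [ht, h]
  have hle : ∀ i : Fin n, cellLower c i ≤ c i ∧ c i ≤ cellUpper c i := by
    intro i
    constructor
    · unfold cellLower
      split_ifs with h0
      · exact (hmem i).1
      · have : c ⟨i.val - 1, by omega⟩ ≤ c i := hmono (Fin.le_def.2 (by simp))
        linarith
    · unfold cellUpper
      split_ifs with h0
      · have : c i ≤ c ⟨i.val + 1, h0⟩ := hmono (Fin.le_def.2 (by simp))
        linarith
      · exact (hmem i).2
  rw [scalarCost, ← ht0, ← htn, ← intervalIntegral.sum_integral_adjacent_intervals fun k hk =>
    intervalIntegrable_mul_betaDensity hd (continuous_minSq_right c) (htmem k hk.le)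
      (htmem (k + 1) hk), ← Fin.sum_univ_eq_sum_range]
  refine Finset.sum_congr rfl fun i _ => ?_
  rw [← hlow, ← hup]
  refine intervalIntegral.integral_congr fun x hx => ?_
  rw [Set.uIcc_of_le ((hle i).1.trans (hle i).2)] at hx
  rw [sq_abs, minSq_eq fun k => ?_]
  suffices h : 0 ≤ (c i - c k) * (2 * x - (c i + c k)) by nlinarith
  rcases lt_trichotomy k i with hki | rfl | hik
  · have hk : k.val < i.val := hki
    have h1 : c k ≤ c ⟨i.val - 1, by omega⟩ := hmono (Fin.le_def.2 (by simp; omega))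
    have h2 := hx.1
    rw [cellLower, if_neg (by omega)] at h2
    exact mul_nonneg (sub_nonneg.2 (hmono hki.le)) (by linarith)
  · simp
  · have hk : i.val < k.val := hik
    have h0 : i.val + 1 < n := by omega
    have h1 : c ⟨i.val + 1, h0⟩ ≤ c k := hmono (Fin.le_def.2 (by simp; omega))
    have h2 := hx.2
    rw [cellUpper, dif_pos h0] at h2
    exact mul_nonneg_of_nonpos_of_nonpos (sub_nonpos.2 (hmono hik.le)) (by linarith)

/-- The error depends continuously on the codebook, and codebooks form a compact set. -/
lemma exists_isLloydMaxCodebook {d : ℕ} (hd : 2 ≤ d) : ∃ c : Fin n → ℝ, IsLloydMaxCodebook d c := by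
  have hset : {c : Fin n → ℝ | IsCodebook c} =
      Set.Icc (fun _ => -1) (fun _ => 1) ∩ {c : Fin n → ℝ | Monotone c} := by
    ext c
    simp only [IsCodebook, Set.mem_ofPred_eq, Set.mem_inter_iff, Set.mem_Icc, Pi.le_def,
      forall_and]
    tauto
  have hcomp : IsCompact {c : Fin n → ℝ | IsCodebook c} := by
    rw [hset]
    exact isCompact_Icc.inter_right isClosed_monotone
  have hne : {c : Fin n → ℝ | IsCodebook c}.Nonempty := ⟨fun _ => 0, monotone_const, by simp⟩
  have hcont : ContinuousOn (scalarCost d) {c : Fin n → ℝ | IsCodebook c} := by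
    refine ContinuousOn.congr (f := fun c => ∫ x in Set.Ioc (-1 : ℝ) 1,
      minSq c x * betaDensity d x) ?_ fun c hc => ?_
    · refine continuousOn_of_dominated (bound := fun x => 4 * betaDensity d x)
        (fun c _ => ?_) (fun c hc => ?_) ?_ ?_
      · exact ((continuous_minSq_right c).measurable.mul
          (measurable_betaDensity d)).aestronglyMeasurable
      · refine (ae_restrict_iff' measurableSet_Ioc).2 (ae_of_all _ fun x hx => ?_)
        have hx' := Set.Ioc_subset_Icc_self hx
        rw [Real.norm_of_nonneg (mul_nonneg (minSq_nonneg c x) (betaDensity_nonneg hd hx'))]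
        exact mul_le_mul_of_nonneg_right (minSq_le_four hc.2 hx') (betaDensity_nonneg hd hx')
      · exact ((intervalIntegrable_iff_integrableOn_Ioc_of_le (by norm_num)).1
          (intervalIntegrable_betaDensity hd)).const_mul 4
      · exact ae_of_all _ fun x =>
          ((continuous_minSq.comp (Continuous.prodMk_left x)).mul continuous_const).continuousOn
    · rw [scalarCost_eq hd hc, intervalIntegral.integral_of_le (by norm_num)]
  obtain ⟨c, hc, hmin⟩ := hcomp.exists_isMinOn hne hcont
  exact ⟨c, hc, fun c' hc' => hmin hc'⟩

/-! ### Codebooks with small error -/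

/-- Uniform cells of length `2 / n`. -/
lemma exists_codebook_uniform {d : ℕ} (hd : 2 ≤ d) :
    ∃ c : Fin n → ℝ, IsCodebook c ∧
      ∫ x in (-1 : ℝ)..1, minSq c x * betaDensity d x ≤ 1 / (n : ℝ) ^ 2 := by
  have hn : (0 : ℝ) < n := by exact_mod_cast Nat.pos_of_ne_zero (NeZero.ne n)
  refine ⟨fun i => (2 * i + 1) / n - 1, ⟨fun i j hij => ?_, fun i => ⟨?_, ?_⟩⟩, ?_⟩
  · have : (i : ℝ) ≤ j := by exact_mod_cast hij
    simp only
    gcongr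
  · have : 0 ≤ (2 * (i : ℝ) + 1) / n := by positivity
    linarith
  · have h1 : ((i : ℕ) : ℝ) + 1 ≤ n := by exact_mod_cast i.2
    have : (2 * (i : ℝ) + 1) / n ≤ 2 := by
      rw [div_le_iff₀ hn]; linarith
    linarith
  set a : ℕ → ℝ := fun k => 2 * k / n - 1 with ha
  have hstep : ∀ k, a k ≤ a (k + 1) := fun k => by
    simp only [ha]
    gcongr
    linarith
  have hmem : ∀ k ≤ n, a k ∈ Set.Icc (-1 : ℝ) 1 := fun k hk => by
    have h1 : (k : ℝ) ≤ n := by exact_mod_cast hk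
    have h2 : 0 ≤ 2 * (k : ℝ) / n := by positivity
    have h3 : 2 * (k : ℝ) / n ≤ 2 := by
      rw [div_le_iff₀ hn]; linarith
    simp only [ha]
    constructor <;> linarith
  have ha0 : a 0 = -1 := by simp [ha]
  have han : a n = 1 := by simp only [ha]; field_simp; norm_num
  refine (integral_minSq_le_sum hd _ ha0 han hmem fun k _ => hstep k).trans ?_
  have hcell : ∀ i : Fin n, ∫ x in (a i)..(a (i + 1)),
      (x - ((2 * i + 1) / n - 1)) ^ 2 * betaDensity d x ≤
        ∫ x in (a i)..(a (i + 1)), 1 / (n : ℝ) ^ 2 * betaDensity d x := by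
    intro i
    refine intervalIntegral.integral_mono_on (hstep i)
      (intervalIntegrable_mul_betaDensity hd (by fun_prop) (hmem i i.2.le) (hmem (i + 1) i.2))
      (intervalIntegrable_mul_betaDensity hd continuous_const (hmem i i.2.le) (hmem (i + 1) i.2))
      fun x hx => ?_
    refine mul_le_mul_of_nonneg_right ?_
      (betaDensity_nonneg hd ⟨(hmem i i.2.le).1.trans hx.1, hx.2.trans (hmem (i + 1) i.2).2⟩)
    rw [one_div, ← inv_pow]
    have h1 := hx.1
    have h2 := hx.2
    simp only [ha] at h1 h2
    push_cast at h2
    have e1 : 2 * (i : ℝ) / n = (2 * i + 1) / n - (n : ℝ)⁻¹ := by field_simp; ring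
    have e2 : 2 * ((i : ℝ) + 1) / n = (2 * i + 1) / n + (n : ℝ)⁻¹ := by field_simp; ring
    exact sq_le_sq' (by linarith) (by linarith)
  refine (Finset.sum_le_sum fun i _ => hcell i).trans ?_
  rw [Fin.sum_univ_eq_sum_range
      (fun i => ∫ x in (a i)..(a (i + 1)), 1 / (n : ℝ) ^ 2 * betaDensity d x),
    intervalIntegral.sum_integral_adjacent_intervals fun k hk =>
    intervalIntegrable_mul_betaDensity hd continuous_const (hmem k hk.le) (hmem (k + 1) hk),
    ha0, han, intervalIntegral.integral_const_mul, integral_betaDensity hd, mul_one]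

lemma betaDensity_eq_cube (d : ℕ) {x : ℝ} (hx : x ∈ Set.Icc (-1 : ℝ) 1) :
    betaDensity d x = densityConst d * ((1 - x ^ 2) ^ (((d : ℝ) - 3) / 6)) ^ 3 := by
  rw [betaDensity_eq, ← Real.rpow_natCast _ 3, ← Real.rpow_mul (one_sub_sq_nonneg hx)]
  congr 2
  push_cast
  ring

/-- Companding: all `n` cells carry the same integral of `h = (1 - x ^ 2) ^ ((d - 3) / 6)`, the cube
root of the density up to a constant, and each centroid halves the integral of its cell. This
attains the asymptotically optimal Panter–Dite constant for every `n`. -/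
lemma exists_codebook_companding {d : ℕ} (hd : 3 ≤ d) :
    ∃ c : Fin n → ℝ, IsCodebook c ∧
      ∫ x in (-1 : ℝ)..1, minSq c x * betaDensity d x ≤
        densityConst d * (∫ x in (-1 : ℝ)..1, (1 - x ^ 2) ^ (((d : ℝ) - 3) / 6)) ^ 3 / 12
          / (n : ℝ) ^ 2 := by
  have hn : (0 : ℝ) < n := by exact_mod_cast Nat.pos_of_ne_zero (NeZero.ne n)
  have hd' : (3 : ℝ) ≤ d := by exact_mod_cast hd
  have hp : 0 ≤ ((d : ℝ) - 3) / 6 := by linarith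
  generalize hpd : ((d : ℝ) - 3) / 6 = p at *
  have hcont := continuous_one_sub_sq_rpow hp
  have hii : ∀ a b, IntervalIntegrable (fun x : ℝ => (1 - x ^ 2) ^ p) volume a b :=
    fun a b => hcont.intervalIntegrable a b
  set F : ℝ → ℝ := fun z => ∫ x in (-1 : ℝ)..z, (1 - x ^ 2) ^ p with hF
  have hFd : ∀ z, HasDerivAt F ((1 - z ^ 2) ^ p) z := fun z =>
    (hcont.integral_hasStrictDerivAt (-1) z).hasDerivAt
  have hFc : Continuous F := continuous_iff_continuousAt.2 fun z => (hFd z).continuousAt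
  have hFm : StrictMonoOn F (Set.Icc (-1) 1) := by
    refine strictMonoOn_of_deriv_pos (convex_Icc _ _) hFc.continuousOn fun z hz => ?_
    rw [interior_Icc] at hz
    rw [(hFd z).deriv]
    exact Real.rpow_pos_of_pos (one_sub_sq_pos hz) _
  have hleft : (-1 : ℝ) ∈ Set.Icc (-1 : ℝ) 1 := by norm_num
  have hright : (1 : ℝ) ∈ Set.Icc (-1 : ℝ) 1 := by norm_num
  have hF0 : F (-1) = 0 := intervalIntegral.integral_same
  change ∃ c : Fin n → ℝ, IsCodebook c ∧ _ ≤ densityConst d * F 1 ^ 3 / 12 / (n : ℝ) ^ 2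
  set L := F 1 with hL
  have hLpos : 0 < L := by
    rw [← hF0]
    exact hFm hleft hright (by norm_num)
  have hex : ∀ t : ℝ, ∃ x, t ∈ Set.Icc (0 : ℝ) 1 → x ∈ Set.Icc (-1 : ℝ) 1 ∧ F x = t * L := by
    intro t
    by_cases ht : t ∈ Set.Icc (0 : ℝ) 1
    · obtain ⟨x, hx, hxt⟩ := intermediate_value_Icc (by norm_num : (-1 : ℝ) ≤ 1) hFc.continuousOn
        (show t * L ∈ Set.Icc (F (-1)) (F 1) from
          ⟨by rw [hF0]; exact mul_nonneg ht.1 hLpos.le, by nlinarith [ht.2]⟩)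
      exact ⟨x, fun _ => ⟨hx, hxt⟩⟩
    · exact ⟨0, fun h => absurd h ht⟩
  choose G hG using hex
  have hGlt : ∀ {s t : ℝ}, s ∈ Set.Icc (0 : ℝ) 1 → t ∈ Set.Icc (0 : ℝ) 1 → s < t → G s < G t := by
    intro s t hs ht hst
    rw [← hFm.lt_iff_lt (hG s hs).1 (hG t ht).1, (hG s hs).2, (hG t ht).2]
    exact mul_lt_mul_of_pos_right hst hLpos
  have h01 : (0 : ℝ) ∈ Set.Icc (0 : ℝ) 1 := by norm_num
  have h11 : (1 : ℝ) ∈ Set.Icc (0 : ℝ) 1 := by norm_num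
  have hG0 : G 0 = -1 := hFm.injOn (hG 0 h01).1 hleft (by rw [(hG 0 h01).2, hF0, zero_mul])
  have hG1 : G 1 = 1 := hFm.injOn (hG 1 h11).1 hright (by rw [(hG 1 h11).2, one_mul])
  have hmid : ∀ i : Fin n, (2 * (i : ℝ) + 1) / (2 * n) ∈ Set.Ioo (0 : ℝ) 1 := by
    intro i
    have h1 : ((i : ℕ) : ℝ) + 1 ≤ n := by exact_mod_cast i.2
    constructor
    · positivity
    · rw [div_lt_one (by positivity)]; linarith
  have hend : ∀ k ≤ n, (k : ℝ) / n ∈ Set.Icc (0 : ℝ) 1 := by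
    intro k hk
    have h1 : (k : ℝ) ≤ n := by exact_mod_cast hk
    exact ⟨by positivity, (div_le_one hn).2 h1⟩
  have hstep : ∀ k < n, G ((k : ℝ) / n) ≤ G (((k + 1 : ℕ) : ℝ) / n) := by
    intro k hk
    refine (hGlt (hend k hk.le) (hend (k + 1) hk) ?_).le
    gcongr
    exact_mod_cast Nat.lt_succ_self k
  set c : Fin n → ℝ := fun i => G ((2 * (i : ℝ) + 1) / (2 * n)) with hc
  have hcm : ∀ i, c i ∈ Set.Ioo (-1 : ℝ) 1 := by
    intro i
    have h := hmid i
    rw [← hG0, ← hG1]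
    exact ⟨hGlt h01 ⟨h.1.le, h.2.le⟩ h.1, hGlt ⟨h.1.le, h.2.le⟩ h11 h.2⟩
  have hmem : ∀ k ≤ n, G ((k : ℝ) / n) ∈ Set.Icc (-1 : ℝ) 1 := fun k hk => (hG _ (hend k hk)).1
  refine ⟨c, ⟨?_, fun i => Set.Ioo_subset_Icc_self (hcm i)⟩, ?_⟩
  · refine StrictMono.monotone fun i j hij => hGlt (Set.Ioo_subset_Icc_self (hmid i))
      (Set.Ioo_subset_Icc_self (hmid j)) ?_
    have : (i : ℝ) < j := by exact_mod_cast hij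
    gcongr
  refine (integral_minSq_le_sum (by omega) c (a := fun k => G ((k : ℝ) / n)) (by simp [hG0])
    (by simp [hn.ne', hG1]) hmem hstep).trans ?_
  have hcell : ∀ i : Fin n, ∫ x in (G (((i : ℕ) : ℝ) / n))..(G (((i + 1 : ℕ) : ℝ) / n)),
      (x - c i) ^ 2 * betaDensity d x ≤ densityConst d * (2 * (L / (2 * n)) ^ 3 / 3) := by
    intro i
    have hm1 := hmem i i.2.le
    have hm2 := hmem (i + 1) i.2
    have hFa := (hG _ (hend i i.2.le)).2
    have hFb := (hG _ (hend (i + 1) i.2)).2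
    have hFm := (hG _ (Set.Ioo_subset_Icc_self (hmid i))).2
    have hsub : ∀ x y, ∫ z in x..y, (1 - z ^ 2) ^ p = F y - F x := fun x y =>
      (intervalIntegral.integral_interval_sub_left (hii _ _) (hii _ _)).symm
    have hle := integral_cell_le hp (hstep i i.2) hm1.1 hm2.2 (hcm i) (δ := L / (2 * n))
      (by rw [hsub, hFa, hFm]; field_simp; ring)
      (by rw [hsub, hFb, hFm]; push_cast; field_simp; ring)
    have hcongr : ∫ x in (G (((i : ℕ) : ℝ) / n))..(G (((i + 1 : ℕ) : ℝ) / n)),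
        (x - c i) ^ 2 * betaDensity d x =
          ∫ x in (G (((i : ℕ) : ℝ) / n))..(G (((i + 1 : ℕ) : ℝ) / n)),
            densityConst d * ((x - c i) ^ 2 * ((1 - x ^ 2) ^ p) ^ 3) := by
      refine intervalIntegral.integral_congr fun x hx => ?_
      rw [Set.uIcc_of_le (hstep i i.2)] at hx
      rw [betaDensity_eq_cube d ⟨hm1.1.trans hx.1, hx.2.trans hm2.2⟩, hpd]
      ring
    rw [hcongr, intervalIntegral.integral_const_mul]
    exact mul_le_mul_of_nonneg_left hle (densityConst_pos (by omega)).le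
  refine (Finset.sum_le_sum fun i _ => hcell i).trans (le_of_eq ?_)
  rw [Finset.sum_const, Finset.card_univ, Fintype.card_fin, nsmul_eq_mul]
  field_simp
  ring

/-- The distortion bound for a Lloyd–Max codebook of a coordinate on the unit sphere. -/
lemma IsLloydMaxCodebook.mul_integral_minSq_le {d : ℕ} (hd : 2 ≤ d) {c : Fin n → ℝ}
    (hc : IsLloydMaxCodebook d c) :
    d * ∫ x in (-1 : ℝ)..1, minSq c x * betaDensity d x ≤
      Real.sqrt 3 * Real.pi / 2 / (n : ℝ) ^ 2 := by
  have hn : (0 : ℝ) < n := by exact_mod_cast Nat.pos_of_ne_zero (NeZero.ne n)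
  obtain ⟨hcb, hmin⟩ := hc
  rcases hd.eq_or_lt with rfl | hd3
  · -- The arcsine density is not log-concave, but the crude bound suffices since `2 ≤ √3 π / 2`.
    obtain ⟨c', hc', hb⟩ := exists_codebook_uniform (n := n) le_rfl
    have h := hmin c' hc'
    rw [scalarCost_eq le_rfl hcb, scalarCost_eq le_rfl hc'] at h
    have h3 : (1.7 : ℝ) ≤ Real.sqrt 3 := Real.le_sqrt_of_sq_le (by norm_num)
    have hpi := Real.pi_gt_three
    calc _ ≤ ((2 : ℕ) : ℝ) * (1 / (n : ℝ) ^ 2) := by gcongr; exact h.trans hb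
      _ = 2 / (n : ℝ) ^ 2 := by push_cast; ring
      _ ≤ _ := by gcongr; nlinarith
  · obtain ⟨c', hc', hb⟩ := exists_codebook_companding (n := n) (d := d) hd3
    have h := hmin c' hc'
    rw [scalarCost_eq hd hcb, scalarCost_eq hd hc'] at h
    refine (mul_le_mul_of_nonneg_left (h.trans hb) (Nat.cast_nonneg d)).trans ?_
    rw [← mul_div_assoc]
    gcongr
    exact mul_densityConst_mul_integral_cube_le hd

end

/-! ### A coordinate of a rotation-invariant unit vector -/

open scoped ENNReal RealInnerProductSpace

lemma lintegral_fun_norm {E : Type*} [NormedAddCommGroup E] [NormedSpace ℝ E]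
    [FiniteDimensional ℝ E] [Nontrivial E] [MeasurableSpace E] [BorelSpace E] (μ : Measure E)
    [μ.IsAddHaarMeasure] {g : ℝ → ℝ≥0∞} (hg : Measurable g) :
    ∫⁻ x, g ‖x‖ ∂μ = μ.toSphere Set.univ *
      ∫⁻ r in Set.Ioi (0 : ℝ), ENNReal.ofReal (r ^ (Module.finrank ℝ E - 1)) * g r := by
  calc ∫⁻ x, g ‖x‖ ∂μ
      = ∫⁻ x : ({(0 : E)}ᶜ : Set E), g ‖x.1‖ ∂(μ.comap (↑)) := by
        rw [lintegral_subtype_comap (measurableSet_singleton _).compl fun x => g ‖x‖,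
          restrict_compl_singleton]
    _ = ∫⁻ z, g z.2 ∂μ.toSphere.prod (.volumeIoiPow (Module.finrank ℝ E - 1)) := by
        simpa using μ.measurePreserving_homeomorphUnitSphereProd.lintegral_comp_emb
          (Homeomorph.measurableEmbedding _) (fun z => g z.2)
    _ = μ.toSphere Set.univ *
          ∫⁻ r : Set.Ioi (0 : ℝ), g r ∂.volumeIoiPow (Module.finrank ℝ E - 1) := by
        rw [lintegral_prod _ (by fun_prop)]
        simp [mul_comm]
    _ = _ := by
        rw [Measure.volumeIoiPow, lintegral_withDensity_eq_lintegral_mul _ (by fun_prop)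
          (by fun_prop), ← lintegral_subtype_comap measurableSet_Ioi]
        rfl

lemma lintegral_Ioi_comp_mul_left {c : ℝ} (hc : 0 < c) (g : ℝ → ℝ≥0∞) :
    ∫⁻ r in Set.Ioi (0 : ℝ), g r = ENNReal.ofReal c * ∫⁻ r in Set.Ioi (0 : ℝ), g (c * r) := by
  have himg : (fun r => c * r) '' Set.Ioi (0 : ℝ) = Set.Ioi 0 := by
    rw [Set.image_mul_left_Ioi hc, mul_zero]
  have h := lintegral_image_eq_lintegral_abs_deriv_mul (s := Set.Ioi (0 : ℝ)) (f := fun r => c * r)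
    (f' := fun _ => c) measurableSet_Ioi
    (fun x _ => by simpa using ((hasDerivAt_id x).const_mul c).hasDerivWithinAt)
    (fun x _ y _ hxy => mul_left_cancel₀ hc.ne' hxy) g
  rw [himg, abs_of_pos hc] at h
  rw [h, lintegral_const_mul' _ _ ENNReal.ofReal_ne_top]

/-- The substitution `x = r * s / √(1 - s ^ 2)`, for which `s = x / √(x ^ 2 + r ^ 2)`. -/
lemma lintegral_eq_lintegral_Ioo_slope {r : ℝ} (hr : 0 < r) (g : ℝ → ℝ → ℝ≥0∞) :
    ∫⁻ x : ℝ, g (x ^ 2 + r ^ 2) (x / Real.sqrt (x ^ 2 + r ^ 2)) =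
      ∫⁻ s in Set.Ioo (-1 : ℝ) 1, ENNReal.ofReal (r / Real.sqrt (1 - s ^ 2) ^ 3) *
        g (r ^ 2 / (1 - s ^ 2)) s := by
  set f : ℝ → ℝ := fun s => r * (s / Real.sqrt (1 - s ^ 2)) with hf
  have hsq : ∀ s ∈ Set.Ioo (-1 : ℝ) 1, f s ^ 2 + r ^ 2 = r ^ 2 / (1 - s ^ 2) := by
    intro s hs
    have hw := one_sub_sq_pos hs
    simp only [hf]
    rw [mul_pow, div_pow, Real.sq_sqrt hw.le]
    field_simp
    ring
  have hinv : ∀ s ∈ Set.Ioo (-1 : ℝ) 1, f s / Real.sqrt (f s ^ 2 + r ^ 2) = s := by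
    intro s hs
    have hw := one_sub_sq_pos hs
    have hw' := Real.sqrt_pos.2 hw
    rw [hsq s hs, Real.sqrt_div (sq_nonneg r), Real.sqrt_sq hr.le]
    simp only [hf]
    field_simp
  have himg : f '' Set.Ioo (-1) 1 = Set.univ := by
    refine Set.eq_univ_of_forall fun x => ?_
    have hN : 0 < x ^ 2 + r ^ 2 := by positivity
    have hN' := Real.sqrt_pos.2 hN
    have hNs := Real.sq_sqrt hN.le
    have hlt : |x| < Real.sqrt (x ^ 2 + r ^ 2) :=
      Real.lt_sqrt (abs_nonneg x) |>.2 (by rw [sq_abs]; nlinarith)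
    refine ⟨x / Real.sqrt (x ^ 2 + r ^ 2), ?_, ?_⟩
    · rw [Set.mem_Ioo, lt_div_iff₀ hN', div_lt_iff₀ hN']
      constructor <;> linarith [(abs_lt.1 hlt).1, (abs_lt.1 hlt).2]
    · have e : 1 - (x / Real.sqrt (x ^ 2 + r ^ 2)) ^ 2 = r ^ 2 / (x ^ 2 + r ^ 2) := by
        rw [div_pow, hNs]; field_simp; ring
      simp only [hf]
      rw [e, Real.sqrt_div (sq_nonneg r), Real.sqrt_sq hr.le]
      field_simp
  have hderiv : ∀ s ∈ Set.Ioo (-1 : ℝ) 1, HasDerivWithinAt f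
      (r / Real.sqrt (1 - s ^ 2) ^ 3) (Set.Ioo (-1) 1) s := by
    intro s hs
    have hw := one_sub_sq_pos hs
    have hw' := Real.sqrt_pos.2 hw
    have hws := Real.sq_sqrt hw.le
    have h1 : HasDerivAt (fun s : ℝ => 1 - s ^ 2) (-(2 * s)) s := by
      simpa using (hasDerivAt_pow 2 s).const_sub 1
    refine (((hasDerivAt_id s).div (h1.sqrt hw.ne') hw'.ne').const_mul r).hasDerivWithinAt
      |>.congr_deriv ?_
    simp only [id]
    have e : s ^ 2 = 1 - Real.sqrt (1 - s ^ 2) ^ 2 := by rw [hws]; ring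
    generalize Real.sqrt (1 - s ^ 2) = w at *
    field_simp
    linear_combination e
  have h := lintegral_image_eq_lintegral_abs_deriv_mul measurableSet_Ioo hderiv
    (fun s hs t ht hst => by
      rw [← hinv s hs, ← hinv t ht, hst])
    (fun x => g (x ^ 2 + r ^ 2) (x / Real.sqrt (x ^ 2 + r ^ 2)))
  rw [himg, Measure.restrict_univ] at h
  rw [h]
  refine setLIntegral_congr_fun measurableSet_Ioo fun s hs => ?_
  have hw' := Real.sqrt_pos.2 (one_sub_sq_pos hs)
  rw [hinv s hs, hsq s hs, abs_of_pos (by positivity)]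

/-- The law of the slope `x / √(x ^ 2 + r ^ 2)` under the weight `r ^ k * exp (-(x ^ 2 + r ^ 2))` on
the half plane `0 < r`. -/
lemma exists_lintegral_slope_eq (k : ℕ) : ∃ K : ℝ≥0∞, ∀ φ : ℝ → ℝ≥0∞, Measurable φ →
    ∫⁻ r in Set.Ioi (0 : ℝ), ENNReal.ofReal (r ^ k) *
        ∫⁻ x : ℝ, ENNReal.ofReal (Real.exp (-(x ^ 2 + r ^ 2))) *
          φ (x / Real.sqrt (x ^ 2 + r ^ 2)) =
      K * ∫⁻ s in Set.Ioo (-1 : ℝ) 1,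
        ENNReal.ofReal ((1 - s ^ 2) ^ (((k : ℝ) - 1) / 2)) * φ s := by
  set K := ∫⁻ r in Set.Ioi (0 : ℝ), ENNReal.ofReal (r ^ (k + 1) * Real.exp (-r ^ 2)) with hK
  refine ⟨K, fun φ hφ => ?_⟩
  calc _ = ∫⁻ r in Set.Ioi (0 : ℝ), ∫⁻ s in Set.Ioo (-1 : ℝ) 1,
          ENNReal.ofReal (r ^ k) * (ENNReal.ofReal (r / Real.sqrt (1 - s ^ 2) ^ 3) *
            (ENNReal.ofReal (Real.exp (-(r ^ 2 / (1 - s ^ 2)))) * φ s)) := by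
        refine setLIntegral_congr_fun measurableSet_Ioi fun r hr => ?_
        rw [lintegral_eq_lintegral_Ioo_slope hr
          (fun N s => ENNReal.ofReal (Real.exp (-N)) * φ s),
          lintegral_const_mul' _ _ ENNReal.ofReal_ne_top]
    _ = ∫⁻ s in Set.Ioo (-1 : ℝ) 1, ∫⁻ r in Set.Ioi (0 : ℝ),
          ENNReal.ofReal (r ^ k) * (ENNReal.ofReal (r / Real.sqrt (1 - s ^ 2) ^ 3) *
            (ENNReal.ofReal (Real.exp (-(r ^ 2 / (1 - s ^ 2)))) * φ s)) :=
        lintegral_lintegral_swap (by fun_prop)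
    _ = ∫⁻ s in Set.Ioo (-1 : ℝ) 1,
          K * (ENNReal.ofReal ((1 - s ^ 2) ^ (((k : ℝ) - 1) / 2)) * φ s) := by
        refine setLIntegral_congr_fun measurableSet_Ioo fun s hs => ?_
        have hw := one_sub_sq_pos hs
        have hw' := Real.sqrt_pos.2 hw
        have hws := Real.sq_sqrt hw.le
        have e : (1 - s ^ 2) ^ (((k : ℝ) - 1) / 2) * Real.sqrt (1 - s ^ 2) ^ 3 =
            Real.sqrt (1 - s ^ 2) ^ (k + 2) := by
          rw [Real.sqrt_eq_rpow, ← Real.rpow_natCast _ 3, ← Real.rpow_natCast _ (k + 2), ← Real.rpow_mul hw.le,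
            ← Real.rpow_mul hw.le, ← Real.rpow_add hw]
          congr 1
          push_cast
          ring
        have e2 : ∀ r ∈ Set.Ioi (0 : ℝ), ENNReal.ofReal ((Real.sqrt (1 - s ^ 2) * r) ^ k) *
            (ENNReal.ofReal (Real.sqrt (1 - s ^ 2) * r / Real.sqrt (1 - s ^ 2) ^ 3) *
              (ENNReal.ofReal (Real.exp (-((Real.sqrt (1 - s ^ 2) * r) ^ 2 / (1 - s ^ 2)))) *
                φ s)) =
            ENNReal.ofReal (r ^ (k + 1) * Real.exp (-r ^ 2)) *
              (ENNReal.ofReal (Real.sqrt (1 - s ^ 2) ^ k / Real.sqrt (1 - s ^ 2) ^ 2) * φ s) := by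
          intro r hr
          have hr' : 0 < r := hr
          have e3 : (Real.sqrt (1 - s ^ 2) * r) ^ 2 / (1 - s ^ 2) = r ^ 2 := by
            rw [mul_pow, hws]
            field_simp
          rw [e3]
          simp only [← mul_assoc]
          rw [← ENNReal.ofReal_mul (by positivity), ← ENNReal.ofReal_mul (by positivity),
            ← ENNReal.ofReal_mul (by positivity)]
          congr 2
          field_simp
          ring
        rw [lintegral_Ioi_comp_mul_left hw', setLIntegral_congr_fun measurableSet_Ioi e2,
          lintegral_mul_const _ (by fun_prop), ← hK, mul_left_comm, ← mul_assoc (ENNReal.ofReal _),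
          ← ENNReal.ofReal_mul hw'.le]
        congr 3
        rw [eq_comm, ← mul_left_inj' (pow_pos hw' 3).ne', e]
        field_simp
        ring
    _ = _ := lintegral_const_mul _ (by fun_prop)

/-- Integral of `φ (e 0 / ‖e‖)` against the rotation-invariant weight `exp (-‖e‖ ^ 2)`. -/
lemma exists_lintegral_direction_eq (m : ℕ) (hm : 1 ≤ m) : ∃ K : ℝ≥0∞, ∀ φ : ℝ → ℝ≥0∞,
    Measurable φ →
    ∫⁻ e : EuclideanSpace ℝ (Fin (m + 1)),
        ENNReal.ofReal (Real.exp (-‖e‖ ^ 2)) * φ (e 0 / ‖e‖) =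
      K * ∫⁻ s in Set.Ioo (-1 : ℝ) 1,
        ENNReal.ofReal ((1 - s ^ 2) ^ (((m : ℝ) - 2) / 2)) * φ s := by
  obtain ⟨K, hK⟩ := exists_lintegral_slope_eq (m - 1)
  have : Nonempty (Fin m) := ⟨⟨0, hm⟩⟩
  set C := (volume : Measure (EuclideanSpace ℝ (Fin m))).toSphere Set.univ with hC
  refine ⟨C * K, fun φ hφ => ?_⟩
  set g : ℝ → ℝ → ℝ≥0∞ := fun r x => ENNReal.ofReal (Real.exp (-(x ^ 2 + r ^ 2))) *
          φ (x / Real.sqrt (x ^ 2 + r ^ 2)) with hg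
  have hmp : MeasurePreserving (fun e : EuclideanSpace ℝ (Fin (m + 1)) =>
      (e 0, (WithLp.toLp 2 (fun i : Fin m => e i.succ) : EuclideanSpace ℝ (Fin m))))
      volume (volume.prod volume) :=
    ((MeasurePreserving.id volume).prod (PiLp.volume_preserving_toLp (Fin m))).comp
      ((volume_preserving_piFinSuccAbove (fun _ : Fin (m + 1) => ℝ) 0).comp
        (PiLp.volume_preserving_ofLp (Fin (m + 1))))
  have hnorm : ∀ e : EuclideanSpace ℝ (Fin (m + 1)), ‖e‖ ^ 2 = e 0 ^ 2 +
      ‖(WithLp.toLp 2 (fun i : Fin m => e i.succ) : EuclideanSpace ℝ (Fin m))‖ ^ 2 := fun e => by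
    rw [EuclideanSpace.real_norm_sq_eq, EuclideanSpace.real_norm_sq_eq, Fin.sum_univ_succ]
  have hgm : Measurable fun z : ℝ × EuclideanSpace ℝ (Fin m) => g ‖z.2‖ z.1 := by
    simp only [hg]
    fun_prop
  have hgr : Measurable fun r => ∫⁻ x, g r x :=
    Measurable.lintegral_prod_right (by simp only [hg, Function.uncurry_def]; fun_prop)
  calc _ = ∫⁻ e : EuclideanSpace ℝ (Fin (m + 1)),
          g ‖(WithLp.toLp 2 (fun i : Fin m => e i.succ) : EuclideanSpace ℝ (Fin m))‖ (e 0) := by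
        refine lintegral_congr fun e => ?_
        simp only [hg]
        rw [← hnorm, Real.sqrt_sq (norm_nonneg _)]
    _ = ∫⁻ z : ℝ × EuclideanSpace ℝ (Fin m), g ‖z.2‖ z.1 ∂volume.prod volume :=
        hmp.lintegral_comp hgm
    _ = ∫⁻ y : EuclideanSpace ℝ (Fin m), (fun r => ∫⁻ x, g r x) ‖y‖ :=
        lintegral_prod_symm _ hgm.aemeasurable
    _ = C * (K * _) := by
        rw [lintegral_fun_norm volume hgr, ← hC, finrank_euclideanSpace_fin, ← hK φ hφ]
    _ = _ := by
        rw [mul_assoc, show (((m - 1 : ℕ) : ℝ) - 1) / 2 = ((m : ℝ) - 2) / 2 by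
          rw [Nat.cast_sub hm]; push_cast; ring]

lemma exists_linearIsometryEquiv_apply_eq {E : Type*} [NormedAddCommGroup E]
    [InnerProductSpace ℝ E] {u v : E} (h : ‖u‖ = ‖v‖) : ∃ V : E ≃ₗᵢ[ℝ] E, V u = v :=
  ⟨_, Submodule.reflection_sub h⟩

/-- Any coordinate of a rotation-invariant unit vector `y` has density `betaDensity`. The function
`φ (⟪e, y⟫ / ‖e‖)` is averaged over `y` and over an independent `e` with weight `exp (-‖e‖ ^ 2)`: by
rotation invariance in `y` the direction of `e` can be fixed, and by rotation invariance in `e` so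
can `y`. -/
lemma lintegral_coord_of_rotationInvariant {d : ℕ} (hd : 2 ≤ d)
    (ν : Measure (EuclideanSpace ℝ (Fin d))) [IsProbabilityMeasure ν] (hν : ∀ᵐ y ∂ν, ‖y‖ = 1)
    (hrot : ∀ V : EuclideanSpace ℝ (Fin d) ≃ₗᵢ[ℝ] EuclideanSpace ℝ (Fin d), ν.map V = ν)
    (j : Fin d) {φ : ℝ → ℝ≥0∞} (hφ : Measurable φ) :
    ∫⁻ y, φ (y j) ∂ν = ∫⁻ s in Set.Ioo (-1 : ℝ) 1, ENNReal.ofReal (betaDensity d s) * φ s := by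
  obtain ⟨m, rfl⟩ : ∃ m, d = m + 1 := ⟨d - 1, by omega⟩
  set E := EuclideanSpace ℝ (Fin (m + 1))
  have : Nontrivial E := inferInstance
  set Z := ∫⁻ e : E, ENNReal.ofReal (Real.exp (-‖e‖ ^ 2)) with hZ
  have hZval : Z = ENNReal.ofReal (Real.pi ^ ((Module.finrank ℝ E : ℝ) / 2)) := by
    have h := GaussianFourier.integral_rexp_neg_mul_sq_norm (V := E) one_pos
    simp only [neg_mul, one_mul, div_one] at h
    rw [← h, ofReal_integral_eq_lintegral_ofReal]
    · exact Integrable.of_integral_ne_zero (by rw [h]; exact (Real.rpow_pos_of_pos Real.pi_pos _).ne')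
    · exact ae_of_all _ fun _ => (Real.exp_pos _).le
  have hZ0 : Z ≠ 0 := by
    rw [hZval, Ne, ENNReal.ofReal_eq_zero, not_le]
    exact Real.rpow_pos_of_pos Real.pi_pos _
  have hZtop : Z ≠ ∞ := hZval ▸ ENNReal.ofReal_ne_top
  -- Averaging over `y` first makes `e` drop out.
  have hfirst : ∀ φ : ℝ → ℝ≥0∞, Measurable φ → ∫⁻ e : E, ∫⁻ y,
      ENNReal.ofReal (Real.exp (-‖e‖ ^ 2)) * φ (⟪e, y⟫ / ‖e‖) ∂ν = Z * ∫⁻ y, φ (y j) ∂ν := by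
    intro φ hφ
    rw [hZ, ← lintegral_mul_const _ (by fun_prop)]
    refine lintegral_congr_ae ?_
    have hne : ∀ᵐ e : E, e ≠ 0 := by simp [ae_iff]
    filter_upwards [hne] with e he
    rw [lintegral_const_mul _ (by fun_prop)]
    congr 1
    obtain ⟨V, hV⟩ := exists_linearIsometryEquiv_apply_eq
      (u := EuclideanSpace.single j (1 : ℝ)) (v := ‖e‖⁻¹ • e) (by
        rw [norm_smul, norm_inv, norm_norm, inv_mul_cancel₀ (norm_ne_zero_iff.2 he)]; simp)
    have hVm : Measurable V := V.continuous.measurable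
    conv_lhs => rw [← hrot V]
    rw [lintegral_map (by fun_prop) hVm]
    refine lintegral_congr fun y => ?_
    have h1 : ⟪e, V y⟫ / ‖e‖ = ⟪‖e‖⁻¹ • e, V y⟫ := by
      rw [real_inner_smul_left]; ring
    rw [h1, ← hV, V.inner_map_map]
    simp [EuclideanSpace.inner_single_left]
  -- Averaging over `e` first makes `y` drop out.
  have hsecond : ∀ φ : ℝ → ℝ≥0∞, Measurable φ → ∫⁻ e : E, ∫⁻ y,
      ENNReal.ofReal (Real.exp (-‖e‖ ^ 2)) * φ (⟪e, y⟫ / ‖e‖) ∂ν =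
        ∫⁻ e : E, ENNReal.ofReal (Real.exp (-‖e‖ ^ 2)) * φ (e 0 / ‖e‖) := by
    intro φ hφ
    rw [lintegral_lintegral_swap (by fun_prop)]
    have hconst : ∀ᵐ y ∂ν, ∫⁻ e : E, ENNReal.ofReal (Real.exp (-‖e‖ ^ 2)) * φ (⟪e, y⟫ / ‖e‖) =
        ∫⁻ e : E, ENNReal.ofReal (Real.exp (-‖e‖ ^ 2)) * φ (e 0 / ‖e‖) := by
      filter_upwards [hν] with y hy
      obtain ⟨V, hV⟩ := exists_linearIsometryEquiv_apply_eq
        (u := EuclideanSpace.single (0 : Fin (m + 1)) (1 : ℝ)) (v := y) (by rw [hy]; simp)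
      rw [← (V.measurePreserving).lintegral_comp (by fun_prop)]
      refine lintegral_congr fun e => ?_
      rw [V.norm_map, ← hV, V.inner_map_map]
      simp [EuclideanSpace.inner_single_right]
    rw [lintegral_congr_ae hconst]
    simp
  obtain ⟨K, hK⟩ := exists_lintegral_direction_eq m (by omega)
  have hA := densityConst_pos hd
  have hexp : (((m + 1 : ℕ) : ℝ) - 3) / 2 = ((m : ℝ) - 2) / 2 := by push_cast; ring
  -- Both sides are now proportional, and `φ = 1` fixes the constant.
  have hprop : ∀ φ : ℝ → ℝ≥0∞, Measurable φ →
      ENNReal.ofReal (densityConst (m + 1)) * (Z * ∫⁻ y, φ (y j) ∂ν) =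
        K * ∫⁻ s in Set.Ioo (-1 : ℝ) 1, ENNReal.ofReal (betaDensity (m + 1) s) * φ s := by
    intro φ hφ
    rw [← hfirst φ hφ, hsecond φ hφ, hK φ hφ, mul_left_comm]
    congr 1
    rw [← lintegral_const_mul' _ _ ENNReal.ofReal_ne_top]
    refine lintegral_congr fun s => ?_
    rw [betaDensity_eq, hexp, ENNReal.ofReal_mul hA.le, mul_assoc]
  have hone : ∫⁻ s in Set.Ioo (-1 : ℝ) 1, ENNReal.ofReal (betaDensity (m + 1) s) = 1 := by
    rw [← ofReal_integral_eq_lintegral_ofReal, ← integral_Ioc_eq_integral_Ioo,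
      ← intervalIntegral.integral_of_le (by norm_num), integral_betaDensity hd, ENNReal.ofReal_one]
    · exact ((intervalIntegrable_iff_integrableOn_Ioo_of_le (by norm_num)).1
        (intervalIntegrable_betaDensity hd))
    · exact (ae_restrict_iff' measurableSet_Ioo).2
        (ae_of_all _ fun s hs => betaDensity_nonneg hd (Set.Ioo_subset_Icc_self hs))
  have hK1 := hprop (fun _ => 1) measurable_const
  simp only [lintegral_one, measure_univ, mul_one] at hK1
  rw [hone, mul_one] at hK1
  have h := hprop φ hφ
  rw [← hK1, ← mul_assoc] at h
  refine (ENNReal.mul_right_inj ?_ ?_).1 h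
  · exact mul_ne_zero (by simpa using hA) hZ0
  · exact ENNReal.mul_ne_top ENNReal.ofReal_ne_top hZtop

/-! ### The orthogonal factor of a Gaussian matrix -/

open InnerProductSpace

section GramSchmidt

variable {E : Type*} [NormedAddCommGroup E] [InnerProductSpace ℝ E] {d : ℕ}

lemma gramSchmidt_eq_sub (f : Fin d → E) (n : Fin d) :
    gramSchmidt ℝ f n = f n - ∑ i ∈ Finset.Iio n,
      (⟪gramSchmidt ℝ f i, f n⟫ / ‖gramSchmidt ℝ f i‖ ^ 2) • gramSchmidt ℝ f i :=
  eq_sub_of_add_eq (gramSchmidt_def'' ℝ f n).symm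

lemma gramSchmidt_map_isometry (V : E ≃ₗᵢ[ℝ] E) (f : Fin d → E) (n : Fin d) :
    gramSchmidt ℝ (fun i => V (f i)) n = V (gramSchmidt ℝ f n) := by
  induction n using WellFoundedLT.induction with
  | ind n ih =>
    rw [gramSchmidt_eq_sub, gramSchmidt_eq_sub f n, map_sub, map_sum]
    congr 1
    refine Finset.sum_congr rfl fun i hi => ?_
    rw [ih i (Finset.mem_Iio.1 hi), V.inner_map_map, V.norm_map, map_smul]

lemma gramSchmidtNormed_map_isometry (V : E ≃ₗᵢ[ℝ] E) (f : Fin d → E) (n : Fin d) :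
    gramSchmidtNormed ℝ (fun i => V (f i)) n = V (gramSchmidtNormed ℝ f n) := by
  simp [gramSchmidtNormed, gramSchmidt_map_isometry]

lemma measurable_gramSchmidt [FiniteDimensional ℝ E] [MeasurableSpace E] [BorelSpace E]
    (n : Fin d) : Measurable fun f : Fin d → E => gramSchmidt ℝ f n := by
  induction n using WellFoundedLT.induction with
  | ind n ih =>
    simp_rw [gramSchmidt_eq_sub _ n]
    refine (measurable_pi_apply n).sub (Finset.measurable_sum _ fun i hi => ?_)
    have h := ih i (Finset.mem_Iio.1 hi)
    exact ((h.inner (measurable_pi_apply n)).div (h.norm.pow_const 2)).smul h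

lemma measurable_gramSchmidtNormed [FiniteDimensional ℝ E] [MeasurableSpace E] [BorelSpace E]
    (n : Fin d) : Measurable fun f : Fin d → E => gramSchmidtNormed ℝ f n := by
  have h := measurable_gramSchmidt (E := E) n
  exact (h.norm.inv).smul h

/-- Uniqueness of the QR decomposition: if `f` is an upper triangular combination of an
orthonormal family with positive diagonal, the Gram–Schmidt process recovers the family. -/
lemma gramSchmidtNormed_eq_of_triangular {f q : Fin d → E} (hq : Orthonormal ℝ q)
    {R : Matrix (Fin d) (Fin d) ℝ} (hR : R.BlockTriangular id) (hpos : ∀ i, 0 < R i i)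
    (hf : ∀ k, f k = ∑ l, R l k • q l) (n : Fin d) : gramSchmidtNormed ℝ f n = q n := by
  have hgs : gramSchmidt ℝ f n = R n n • q n := by
    induction n using WellFoundedLT.induction with
    | ind n ih =>
      have hsum : f n = R n n • q n + ∑ i ∈ Finset.Iio n, R i n • q i := by
        rw [hf, ← Finset.sum_insert (f := fun i => R i n • q i) (by simp : n ∉ Finset.Iio n)]
        refine (Finset.sum_subset (Finset.subset_univ _) fun l _ hl => ?_).symm
        simp only [Finset.mem_insert, Finset.mem_Iio, not_or, not_lt] at hl
        rw [hR (lt_of_le_of_ne hl.2 (Ne.symm hl.1)), zero_smul]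
      rw [gramSchmidt_eq_sub]
      nth_rewrite 1 [hsum]
      rw [add_sub_assoc, add_eq_left, sub_eq_zero]
      refine Finset.sum_congr rfl fun i hi => ?_
      rw [ih i (Finset.mem_Iio.1 hi), real_inner_smul_left, hf n, hq.inner_right_fintype,
        norm_smul, hq.1 i, smul_smul, Real.norm_of_nonneg (hpos i).le]
      congr 1
      have := (hpos i).ne'
      field_simp
  rw [gramSchmidtNormed, hgs, norm_smul, hq.1 n, smul_smul, Real.norm_of_nonneg (hpos n).le]
  simp [(hpos n).ne']

end GramSchmidt

section GaussianMatrix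

variable {d : ℕ}

/-- Columns of the matrix with entries `X (i, j)`. -/
def columns (X : EuclideanSpace ℝ (Fin d × Fin d)) (j : Fin d) : EuclideanSpace ℝ (Fin d) :=
  WithLp.toLp 2 fun i => X (i, j)

/-- Image of `u` under the orthogonal matrix which the Gram–Schmidt process makes of the columns
of `X`. -/
def rotated (u : EuclideanSpace ℝ (Fin d)) (X : EuclideanSpace ℝ (Fin d × Fin d)) :
    EuclideanSpace ℝ (Fin d) :=
  ∑ k, u k • gramSchmidtNormed ℝ (columns X) k

lemma measurable_columns : Measurable (columns (d := d)) := by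
  unfold columns
  fun_prop

lemma measurable_rotated (u : EuclideanSpace ℝ (Fin d)) : Measurable (rotated u) :=
  Finset.measurable_sum _ fun k _ =>
    ((measurable_gramSchmidtNormed k).comp measurable_columns).const_smul (u k)

/-- An isometry acting on every column of a matrix is an isometry of the space of matrices. -/
lemma exists_isometry_columns (V : EuclideanSpace ℝ (Fin d) ≃ₗᵢ[ℝ] EuclideanSpace ℝ (Fin d)) :
    ∃ L : EuclideanSpace ℝ (Fin d × Fin d) ≃ₗᵢ[ℝ] EuclideanSpace ℝ (Fin d × Fin d),
      ∀ X, columns (L X) = fun j => V (columns X j) := by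
  let L₀ : EuclideanSpace ℝ (Fin d × Fin d) →ₗ[ℝ] EuclideanSpace ℝ (Fin d × Fin d) :=
    { toFun := fun X => WithLp.toLp 2 fun p => V (columns X p.2) p.1
      map_add' := fun X Y => by
        ext p
        have : columns (X + Y) p.2 = columns X p.2 + columns Y p.2 := rfl
        simp [this]
      map_smul' := fun a X => by
        ext p
        have : columns (a • X) p.2 = a • columns X p.2 := rfl
        simp [this] }
  have hsq : ∀ X : EuclideanSpace ℝ (Fin d × Fin d), ‖X‖ ^ 2 = ∑ j, ‖columns X j‖ ^ 2 := by
    intro X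
    simp_rw [EuclideanSpace.real_norm_sq_eq]
    rw [Fintype.sum_prod_type_right]
    rfl
  have hcol : ∀ X, columns (L₀ X) = fun j => V (columns X j) := fun X => rfl
  have hnorm : ∀ X, ‖L₀ X‖ = ‖X‖ := by
    intro X
    rw [← sq_eq_sq₀ (norm_nonneg _) (norm_nonneg _), hsq, hsq X, hcol]
    simp
  exact ⟨(⟨L₀, hnorm⟩ : EuclideanSpace ℝ (Fin d × Fin d) →ₗᵢ[ℝ] _).toLinearIsometryEquiv rfl, hcol⟩

/-- Rotating a Gaussian matrix from the left does not change its law, so the image of a fixed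
vector under its orthogonal factor is rotation-invariant. -/
lemma map_rotated_stdGaussian (u : EuclideanSpace ℝ (Fin d))
    (V : EuclideanSpace ℝ (Fin d) ≃ₗᵢ[ℝ] EuclideanSpace ℝ (Fin d)) :
    ((stdGaussian (EuclideanSpace ℝ (Fin d × Fin d))).map (rotated u)).map V =
      (stdGaussian (EuclideanSpace ℝ (Fin d × Fin d))).map (rotated u) := by
  obtain ⟨L, hL⟩ := exists_isometry_columns V
  have hcomp : V ∘ rotated u = rotated u ∘ L := by
    funext X
    simp only [Function.comp_apply, rotated, hL, gramSchmidtNormed_map_isometry, map_sum, map_smul]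
  have hV : Measurable V := V.continuous.measurable
  have hLm : Measurable L := L.continuous.measurable
  rw [Measure.map_map hV (measurable_rotated u), hcomp, ← Measure.map_map (measurable_rotated u) hLm,
    stdGaussian_map L]

lemma IsQRFactor.mulVec_eq_rotated {A Q : Matrix (Fin d) (Fin d) ℝ} (h : IsQRFactor A Q)
    (u : EuclideanSpace ℝ (Fin d)) :
    WithLp.toLp 2 (Q.mulVec fun i => u i) = rotated u (WithLp.toLp 2 fun p => A p.1 p.2) := by
  obtain ⟨hQ, R, hR, hpos, hA⟩ := h
  have hQ' : Q.transpose * Q = 1 := (Matrix.mem_orthogonalGroup_iff' (Fin d) ℝ).1 hQ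
  set q : Fin d → EuclideanSpace ℝ (Fin d) := fun k => WithLp.toLp 2 fun i => Q i k with hq
  have hon : Orthonormal ℝ q := by
    rw [orthonormal_iff_ite]
    intro i j
    have := congrFun (congrFun hQ' i) j
    rw [Matrix.mul_apply, Matrix.one_apply] at this
    rw [← this]
    simp [hq, PiLp.inner_apply, mul_comm]
  have hcol : ∀ k, columns (WithLp.toLp 2 fun p : Fin d × Fin d => A p.1 p.2) k =
      ∑ l, R l k • q l := by
    intro k
    ext i
    simp [columns, hA, Matrix.mul_apply, hq, mul_comm]
  simp_rw [rotated, gramSchmidtNormed_eq_of_triangular hon hR hpos hcol]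
  ext i
  simp [hq, Matrix.mulVec, dotProduct, mul_comm]

/-- The law of the matrix entries, as a random vector. -/
lemma map_entries_eq_stdGaussian {Ω : Type*} [MeasurableSpace Ω] {P : Measure Ω}
    [IsProbabilityMeasure P] {G : Ω → Matrix (Fin d) (Fin d) ℝ}
    (hlaw : ∀ i j, HasLaw (fun ω => G ω i j) (gaussianReal 0 1) P)
    (hind : iIndepFun (fun (p : Fin d × Fin d) (ω : Ω) => G ω p.1 p.2) P) :
    AEMeasurable (fun ω => (WithLp.toLp 2 fun p : Fin d × Fin d => G ω p.1 p.2 :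
      EuclideanSpace ℝ (Fin d × Fin d))) P ∧
    P.map (fun ω => (WithLp.toLp 2 fun p : Fin d × Fin d => G ω p.1 p.2 :
      EuclideanSpace ℝ (Fin d × Fin d))) = stdGaussian (EuclideanSpace ℝ (Fin d × Fin d)) := by
  have hm : ∀ p : Fin d × Fin d, AEMeasurable (fun ω => G ω p.1 p.2) P :=
    fun p => (hlaw p.1 p.2).aemeasurable
  have hm' : AEMeasurable (fun ω (p : Fin d × Fin d) => G ω p.1 p.2) P := aemeasurable_pi_lambda _ hm
  have htoLp : Measurable (WithLp.toLp 2 : (Fin d × Fin d → ℝ) → EuclideanSpace ℝ (Fin d × Fin d)) :=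
    by fun_prop
  refine ⟨htoLp.comp_aemeasurable hm', ?_⟩
  rw [← map_pi_eq_stdGaussian]
  have h := (iIndepFun_iff_map_fun_eq_pi_map hm).1 hind
  simp_rw [fun p : Fin d × Fin d => (hlaw p.1 p.2).map_eq] at h
  rw [← h, AEMeasurable.map_map_of_aemeasurable htoLp.aemeasurable hm']
  rfl

/-- A coordinate of the rotated unit vector has density `betaDensity d`. -/
lemma IsRandomRotation.lintegral_coord (hd : 2 ≤ d) {Ω : Type*} [MeasurableSpace Ω]
    {P : Measure Ω} [IsProbabilityMeasure P] {Q : Ω → Matrix (Fin d) (Fin d) ℝ}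
    (hQ : IsRandomRotation P Q) {u : EuclideanSpace ℝ (Fin d)} (hu : ‖u‖ = 1) (j : Fin d) :
    AEMeasurable (fun ω => (Q ω).mulVec (fun i => u i) j) P ∧
    ∀ φ : ℝ → ℝ≥0∞, Measurable φ → ∫⁻ ω, φ ((Q ω).mulVec (fun i => u i) j) ∂P =
      ∫⁻ s in Set.Ioo (-1 : ℝ) 1, ENNReal.ofReal (betaDensity d s) * φ s := by
  obtain ⟨G, hlaw, hind, hqr⟩ := hQ
  obtain ⟨hXm, hX⟩ := map_entries_eq_stdGaussian hlaw hind
  set X : Ω → EuclideanSpace ℝ (Fin d × Fin d) := fun ω =>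
    WithLp.toLp 2 fun p : Fin d × Fin d => G ω p.1 p.2
  have hae : ∀ᵐ ω ∂P, WithLp.toLp 2 ((Q ω).mulVec fun i => u i) = rotated u (X ω) := by
    filter_upwards [hqr] with ω hω using hω.mulVec_eq_rotated u
  have haej : (fun ω => (Q ω).mulVec (fun i => u i) j) =ᵐ[P] fun ω => rotated u (X ω) j := by
    filter_upwards [hae] with ω hω
    rw [← hω]
  have hYm : AEMeasurable (fun ω => rotated u (X ω)) P :=
    (measurable_rotated u).comp_aemeasurable hXm
  have hcoord : Measurable fun y : EuclideanSpace ℝ (Fin d) => y j := by fun_prop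
  refine ⟨(hcoord.comp_aemeasurable hYm).congr haej.symm, fun φ hφ => ?_⟩
  set ν := (stdGaussian (EuclideanSpace ℝ (Fin d × Fin d))).map (rotated u) with hν
  have hνP : ν = P.map fun ω => rotated u (X ω) := by
    rw [hν, ← hX, AEMeasurable.map_map_of_aemeasurable (measurable_rotated u).aemeasurable hXm]
    rfl
  have : IsProbabilityMeasure ν :=
    Measure.isProbabilityMeasure_map (measurable_rotated u).aemeasurable
  have hnorm : ∀ᵐ y ∂ν, ‖y‖ = 1 := by
    rw [hνP, ae_map_iff hYm (measurableSet_eq_fun (by fun_prop) (by fun_prop))]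
    filter_upwards [hae, hqr] with ω hω hω'
    have hQ' := (Matrix.mem_orthogonalGroup_iff' (Fin d) ℝ).1 hω'.1
    rw [← hω, ← hu, ← sq_eq_sq₀ (norm_nonneg _) (norm_nonneg _), EuclideanSpace.real_norm_sq_eq,
      EuclideanSpace.real_norm_sq_eq]
    have h1 : (Q ω).mulVec (fun i => u i) ⬝ᵥ (Q ω).mulVec (fun i => u i) =
        (fun i => u i) ⬝ᵥ (fun i => u i) := by
      rw [Matrix.dotProduct_mulVec, Matrix.vecMul_mulVec, hQ', Matrix.vecMul_one]
    simpa [dotProduct, sq] using h1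
  rw [← lintegral_coord_of_rotationInvariant hd ν hnorm (map_rotated_stdGaussian u) j hφ, hνP,
    lintegral_map' (f := fun y => φ (y j)) (hφ.comp hcoord).aemeasurable hYm]
  refine lintegral_congr_ae ?_
  filter_upwards [haej] with ω hω
  rw [hω]

end GaussianMatrix

/-! ### The reconstruction error -/

/-- Rotating back is an isometry, so the error is the sum of the scalar errors of the coordinates
of the rotated direction. -/
lemma norm_sub_decode_encode_sq {d n : ℕ} [NeZero n] {Q : Matrix (Fin d) (Fin d) ℝ}
    (hQ : Q ∈ Matrix.orthogonalGroup (Fin d) ℝ) {c : Fin n → ℝ} {q : ℝ → Fin n}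
    (hq : IsNearestIndex c q) (v : EuclideanSpace ℝ (Fin d)) :
    ‖v - decode Q c (encode Q q v)‖ ^ 2 =
      ‖v‖ ^ 2 * ∑ j, minSq c (Q.mulVec (fun i => (‖v‖⁻¹ • v) i) j) := by
  rcases eq_or_ne v 0 with rfl | hv
  · simp [decode, encode]
  set u := ‖v‖⁻¹ • v with hu
  have hvu : v = ‖v‖ • u := by
    rw [hu, smul_smul, mul_inv_cancel₀ (norm_ne_zero_iff.2 hv), one_smul]
  have hQ1 : Q.transpose * Q = 1 := (Matrix.mem_orthogonalGroup_iff' (Fin d) ℝ).1 hQ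
  have hQ2 : Q * Q.transpose = 1 := (Matrix.mem_orthogonalGroup_iff (Fin d) ℝ).1 hQ
  set y := Q.mulVec fun i => u i with hy
  set w : Fin d → ℝ := fun j => y j - c (q (y j)) with hw
  have hdiff : v - decode Q c (encode Q q v) = ‖v‖ • WithLp.toLp 2 (Q.transpose.mulVec w) := by
    have e1 : u = WithLp.toLp 2 (Q.transpose.mulVec y) := by
      rw [hy, Matrix.mulVec_mulVec, hQ1, Matrix.one_mulVec]
    have e2 : w = y - fun j => c (q (y j)) := rfl
    rw [e2, Matrix.mulVec_sub, WithLp.toLp_sub, smul_sub, ← e1, ← hvu]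
    rfl
  have hnorm : ‖(WithLp.toLp 2 (Q.transpose.mulVec w) : EuclideanSpace ℝ (Fin d))‖ ^ 2 =
      ∑ j, w j ^ 2 := by
    have h : Q.transpose.mulVec w ⬝ᵥ Q.transpose.mulVec w = w ⬝ᵥ w := by
      rw [Matrix.dotProduct_mulVec, Matrix.vecMul_mulVec, Matrix.transpose_transpose, hQ2,
        Matrix.vecMul_one]
    rw [EuclideanSpace.real_norm_sq_eq]
    simpa [dotProduct, sq] using h
  rw [hdiff, norm_smul, norm_norm, mul_pow, hnorm]
  congr 1
  exact Finset.sum_congr rfl fun j _ => hq.sq_eq_minSq (y j)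

lemma IsRandomRotation.integral_minSq_coord {d n : ℕ} [NeZero n] (hd : 2 ≤ d) {Ω : Type*}
    [MeasurableSpace Ω] {P : Measure Ω} [IsProbabilityMeasure P]
    {Q : Ω → Matrix (Fin d) (Fin d) ℝ} (hQ : IsRandomRotation P Q)
    {u : EuclideanSpace ℝ (Fin d)} (hu : ‖u‖ = 1) (c : Fin n → ℝ) (j : Fin d) :
    Integrable (fun ω => minSq c ((Q ω).mulVec (fun i => u i) j)) P ∧
    ∫ ω, minSq c ((Q ω).mulVec (fun i => u i) j) ∂P =
      ∫ x in (-1 : ℝ)..1, minSq c x * betaDensity d x := by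
  obtain ⟨hYm, hlaw⟩ := hQ.lintegral_coord hd hu j
  have hcm := (continuous_minSq_right c).measurable
  have hae := (hcm.comp_aemeasurable hYm).aestronglyMeasurable
  have hnonneg : ∀ s ∈ Set.Ioo (-1 : ℝ) 1, 0 ≤ minSq c s * betaDensity d s := fun s hs =>
    mul_nonneg (minSq_nonneg c s) (betaDensity_nonneg hd (Set.Ioo_subset_Icc_self hs))
  have hlint : ∫⁻ ω, ENNReal.ofReal (minSq c ((Q ω).mulVec (fun i => u i) j)) ∂P =
      ENNReal.ofReal (∫ x in (-1 : ℝ)..1, minSq c x * betaDensity d x) := by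
    rw [hlaw (fun y => ENNReal.ofReal (minSq c y)) (by fun_prop),
      intervalIntegral.integral_of_le (by norm_num), integral_Ioc_eq_integral_Ioo,
      ofReal_integral_eq_lintegral_ofReal]
    · refine setLIntegral_congr_fun measurableSet_Ioo fun s hs => ?_
      rw [mul_comm (minSq c s),
        ENNReal.ofReal_mul (betaDensity_nonneg hd (Set.Ioo_subset_Icc_self hs))]
    · exact (intervalIntegrable_iff_integrableOn_Ioo_of_le (by norm_num)).1
        (intervalIntegrable_mul_betaDensity hd (continuous_minSq_right c) (by norm_num)
          (by norm_num))
    · exact (ae_restrict_iff' measurableSet_Ioo).2 (ae_of_all _ hnonneg)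
  have hpos : 0 ≤ ∫ x in (-1 : ℝ)..1, minSq c x * betaDensity d x := by
    rw [intervalIntegral.integral_of_le (by norm_num), integral_Ioc_eq_integral_Ioo]
    exact setIntegral_nonneg measurableSet_Ioo hnonneg
  refine ⟨(lintegral_ofReal_ne_top_iff_integrable hae
    (ae_of_all _ fun _ => minSq_nonneg _ _)).1 (hlint ▸ ENNReal.ofReal_ne_top), ?_⟩
  rw [integral_eq_lintegral_of_nonneg_ae (ae_of_all _ fun _ => minSq_nonneg _ _) hae, hlint,
    ENNReal.toReal_ofReal hpos]

/-- Mean squared error of the norm-separated scheme for an arbitrary number `n` of centroids. -/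
lemma IsRandomRotation.integral_error_le {d n : ℕ} [NeZero n] (hd : 2 ≤ d) {Ω : Type*}
    [MeasurableSpace Ω] {P : Measure Ω} [IsProbabilityMeasure P]
    {Q : Ω → Matrix (Fin d) (Fin d) ℝ} (hQ : IsRandomRotation P Q) {c : Fin n → ℝ}
    (hc : IsLloydMaxCodebook d c) {q : ℝ → Fin n} (hq : IsNearestIndex c q)
    (v : EuclideanSpace ℝ (Fin d)) :
    Integrable (fun ω => ‖v - decode (Q ω) c (encode (Q ω) q v)‖ ^ 2) P ∧
    ∫ ω, ‖v - decode (Q ω) c (encode (Q ω) q v)‖ ^ 2 ∂P ≤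
      ‖v‖ ^ 2 * (Real.sqrt 3 * Real.pi / 2 / (n : ℝ) ^ 2) := by
  rcases eq_or_ne v 0 with rfl | hv
  · simp [decode, encode]
  have hu : ‖‖v‖⁻¹ • v‖ = 1 := by
    rw [norm_smul, norm_inv, norm_norm, inv_mul_cancel₀ (norm_ne_zero_iff.2 hv)]
  have hae : (fun ω => ‖v - decode (Q ω) c (encode (Q ω) q v)‖ ^ 2) =ᵐ[P] fun ω =>
      ‖v‖ ^ 2 * ∑ j, minSq c ((Q ω).mulVec (fun i => (‖v‖⁻¹ • v) i) j) := by
    obtain ⟨G, -, -, hqr⟩ := hQ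
    filter_upwards [hqr] with ω hω using norm_sub_decode_encode_sq hω.1 hq v
  have hcoord := hQ.integral_minSq_coord hd hu c
  refine ⟨((integrable_finsetSum _ fun j _ => (hcoord j).1).const_mul _).congr hae.symm, ?_⟩
  rw [integral_congr_ae hae, integral_const_mul, integral_finsetSum _ fun j _ => (hcoord j).1]
  simp_rw [fun j => (hcoord j).2]
  rw [Finset.sum_const, Finset.card_univ, Fintype.card_fin, nsmul_eq_mul]
  exact mul_le_mul_of_nonneg_left (hc.mul_integral_minSq_le hd) (sq_nonneg _)

end TurboQuant

end

theorem mainTheorem1 {Ω : Type*} [MeasurableSpace Ω] (P : Measure Ω) [IsProbabilityMeasure P]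
    (d b N : ℕ) (hd : 2 ≤ d) (hb : 1 ≤ b)
    (Q : Ω → Matrix (Fin d) (Fin d) ℝ) (hQ : TurboQuant.IsRandomRotation P Q)
    (f : Fin N → EuclideanSpace ℝ (Fin d)) :
    (∃ c : Fin (2 ^ b) → ℝ, TurboQuant.IsLloydMaxCodebook d c) ∧
    ∀ c : Fin (2 ^ b) → ℝ, TurboQuant.IsLloydMaxCodebook d c →
    ∀ q : ℝ → Fin (2 ^ b), TurboQuant.IsNearestIndex c q →
    ∀ i : Fin N,
      Integrable (fun ω => ‖f i - TurboQuant.decode (Q ω) c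
        (TurboQuant.encode (Q ω) q (f i))‖ ^ 2) P ∧
      ∫ ω, ‖f i - TurboQuant.decode (Q ω) c (TurboQuant.encode (Q ω) q (f i))‖ ^ 2 ∂P
        ≤ ‖f i‖ ^ 2 * (Real.sqrt 3 * Real.pi / 2) * (1 / 4 ^ b) := by
  refine ⟨TurboQuant.exists_isLloydMaxCodebook hd, fun c hc q hq i => ?_⟩
  obtain ⟨hint, hle⟩ := hQ.integral_error_le hd hc hq (f i)
  refine ⟨hint, hle.trans (le_of_eq ?_)⟩
  have h4 : ((2 : ℝ) ^ b) ^ 2 = 4 ^ b := by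
    rw [← pow_mul, mul_comm, pow_mul]
    norm_num
  push_cast
  rw [h4]
  ring
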